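/- Let $\tilde H^{-1/2}(-1,1)$ be the space of distributions $\lambda \in H^{-1/2}(\mathbb{R})$ (complex valued) with support contained in $[-1,1]$. Let $S_0$ be the single-layer operator of the Laplace equation ($k=0$) on the flat segment $[-1,1]\times\{0\}$, $$S_0\lambda(x) = -\frac{1}{2\pi}\int_{-1}^{1}\log|x-y|\,\lambda(y)\,dy, \qquad x\in(-1,1),$$ where for $\lambda\in\tilde H^{-1/2}(-1,1)$ the integral is understood in the sense of distributions: $S_0\lambda$ is the restriction to $(-1,1)$ of the convolution $G_0*\lambda$ with $G_0(x)=-\frac{1}{2\pi}\log|x|$. Let $g\in C^\infty([-1,1])$. Then the equation $S_0\lambda = g$ on $(-1,1)$ has exactly one solution $\lambda\in\tilde H^{-1/2}(-1,1)$, and this solution has the form $$\lambda(x)=\frac{\alpha(x)}{\sqrt{1-x^2}}\quad (x \in (-1,1)) \qquad\text{with } \alpha\in C^\infty([-1,1]),$$ that is, $\langle\lambda,\varphi\rangle=\int_{-1}^{1}\frac{\alpha(x)}{\sqrt{1-x^2}}\,\varphi(x)\,dx$ for every Schwartz function $\varphi$ on $\mathbb{R}$. -/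

import Mathlib

open MeasureTheory TopologicalSpace SchwartzMap TemperedDistribution
open scoped ContDiff Distributions Convolution

noncomputable section

namespace FlatScreen

/-- The open segment `(-1, 1)`, as an open subset of the line. -/
def segmentInterior : Opens ℝ := ⟨Set.Ioo (-1) 1, isOpen_Ioo⟩

/-- The space `H̃^s(-1, 1)`: the distributions in the Sobolev space `H^s(ℝ)` that are supported in
the closed segment `[-1, 1]`. -/
def HTilde (s : ℝ) : Set 𝓢'(ℝ, ℂ) :=
  {u | MemSobolev s 2 u ∧ Distribution.dsupport u ⊆ Set.Icc (-1) 1}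

/-- The Green kernel `G₀(x) = -(1 / 2π) log |x|` of the Laplace equation (wavenumber `k = 0`). -/
def greenKernel (x : ℝ) : ℝ := -(1 / (2 * Real.pi)) * Real.log |x|

/-- The classical single-layer potential of a test function `φ ∈ C_c^∞(-1, 1)`,
`x ↦ -(1 / 2π) ∫ log |x - y| φ(y) dy`, here at every point `x` of the line. -/
def potential (φ : 𝓓(segmentInterior, ℂ)) (x : ℝ) : ℂ := ∫ y, greenKernel (x - y) • φ y

theorem locallyIntegrable_greenKernel : LocallyIntegrable greenKernel := by
  have h : LocallyIntegrable (fun x : ℝ => Real.log |x|) := by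
    rw [locallyIntegrable_iff]
    intro K hK
    obtain ⟨r, hr⟩ := hK.isBounded.subset_closedBall 0
    have h0 : IntervalIntegrable (fun x : ℝ => Real.log |x|) volume (-|r|) |r| := by
      simpa only [Real.log_abs] using intervalIntegral.intervalIntegrable_log'
    rw [intervalIntegrable_iff_integrableOn_Icc_of_le (by linarith [abs_nonneg r])] at h0
    refine h0.mono_set (hr.trans fun x hx => ?_)
    rw [Metric.mem_closedBall, dist_zero_right, Real.norm_eq_abs] at hx
    exact abs_le.mp (hx.trans (le_abs_self r))
  exact h.smul (-(1 / (2 * Real.pi)))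

/-- The potential of a test function is smooth on the whole line. -/
theorem contDiff_potential (φ : 𝓓(segmentInterior, ℂ)) : ContDiff ℝ ∞ (potential φ) := by
  have h : potential φ = greenKernel ⋆[ContinuousLinearMap.lsmul ℝ ℝ, volume] φ := by
    funext x
    rw [convolution_eq_swap]
    rfl
  rw [h]
  exact φ.hasCompactSupport.contDiff_convolution_right _ locallyIntegrable_greenKernel φ.contDiff

/-- A smooth cutoff function, equal to `1` on `[-2, 2]` and to `0` outside `(-3, 3)`. -/
def cutoff : ContDiffBump (0 : ℝ) := ⟨2, 3, by norm_num, by norm_num⟩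

/-- The potential of a test function, cut off away from `[-2, 2]` so that it is a Schwartz
function. -/
def cutoffPotential (φ : 𝓓(segmentInterior, ℂ)) : 𝓢(ℝ, ℂ) :=
  HasCompactSupport.toSchwartzMap (f := fun x => cutoff x • potential φ x)
    cutoff.hasCompactSupport.smul_right (cutoff.contDiff.smul (contDiff_potential φ))

/-- The single-layer operator `S₀` on distributions `u` supported in `[-1, 1]`: `S₀ u` is the
restriction to `(-1, 1)` of the convolution `G₀ * u`, that is, the distribution
`φ ↦ ⟨u, G₀ * φ⟩` on `(-1, 1)` (recall that `G₀` is even). As `u` is supported in `[-1, 1]`, the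
cutoff of the smooth function `G₀ * φ` away from `[-2, 2]` does not affect the bracket. -/
def singleLayer (u : 𝓢'(ℝ, ℂ)) (φ : 𝓓(segmentInterior, ℂ)) : ℂ := u (cutoffPotential φ)

/-- On test functions, `S₀` is the classical single-layer potential. -/
theorem singleLayer_testFunction (φ ψ : 𝓓(segmentInterior, ℂ)) :
    singleLayer (SchwartzMap.toTemperedDistributionCLM ℝ ℂ volume
      (φ.hasCompactSupport.toSchwartzMap φ.contDiff)) ψ =
      ∫ x in Set.Ioo (-1 : ℝ) 1, potential φ x * ψ x := by
  have hzero : ∀ (χ : 𝓓(segmentInterior, ℂ)) (x : ℝ), x ∉ Set.Ioo (-1 : ℝ) 1 → χ x = 0 :=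
    fun χ x hx => image_eq_zero_of_notMem_tsupport fun h => hx (χ.tsupport_subset h)
  have hint : ∀ χ : 𝓓(segmentInterior, ℂ), Integrable χ := fun χ =>
    χ.continuous.integrable_of_hasCompactSupport χ.hasCompactSupport
  set G : ℝ → ℝ := (Set.Icc (-2) 2).indicator greenKernel with hG
  have hGint : Integrable G :=
    (locallyIntegrable_greenKernel.integrableOn_isCompact isCompact_Icc).integrable_indicator
      measurableSet_Icc
  have hprod : Integrable (fun p : ℝ × ℝ => G (p.1 - p.2) • (ψ p.2 * φ p.1))
      (volume.prod volume) := by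
    have h1 : Integrable (fun p : ℝ × ℝ => G (p.1 - p.2) • ψ p.2) (volume.prod volume) := by
      simpa using (hint ψ).convolution_integrand (ContinuousLinearMap.lsmul ℝ ℝ).flip hGint
    obtain ⟨C, hC⟩ := φ.hasCompactSupport.exists_bound_of_continuous φ.continuous
    have h2 := h1.mul_bdd (c := C) (g := fun p : ℝ × ℝ => φ p.1)
      (φ.continuous.comp continuous_fst).aestronglyMeasurable
      (Filter.Eventually.of_forall fun p => hC p.1)
    simpa [mul_assoc] using h2
  have hGeq : ∀ x y : ℝ, G (x - y) • (ψ y * φ x) = greenKernel (x - y) • (ψ y * φ x) := by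
    intro x y
    by_cases hx : x ∈ Set.Ioo (-1 : ℝ) 1
    · by_cases hy : y ∈ Set.Ioo (-1 : ℝ) 1
      · rw [hG, Set.indicator_of_mem]
        exact ⟨by linarith [hx.1, hy.2], by linarith [hx.2, hy.1]⟩
      · simp [hzero ψ y hy]
    · simp [hzero φ x hx]
  have hsymm : ∀ x y : ℝ, greenKernel (x - y) = greenKernel (y - x) := fun x y => by
    simp only [greenKernel, abs_sub_comm]
  have hL : ∀ x : ℝ, φ x • cutoffPotential ψ x = ∫ y, G (x - y) • (ψ y * φ x) := by
    intro x
    simp only [hGeq, ← smul_mul_assoc]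
    rw [integral_mul_const]
    change φ x • (cutoff x • potential ψ x) = potential ψ x * φ x
    by_cases hx : x ∈ Set.Ioo (-1 : ℝ) 1
    · rw [cutoff.one_of_mem_closedBall, one_smul, smul_eq_mul, mul_comm]
      rw [Metric.mem_closedBall, dist_zero_right, Real.norm_eq_abs]
      exact (abs_lt.mpr hx).le.trans (by norm_num [cutoff])
    · simp [hzero φ x hx]
  have hR : ∀ y : ℝ, ∫ x, G (x - y) • (ψ y * φ x) = potential φ y * ψ y := by
    intro y
    rw [potential, ← integral_mul_const]
    refine integral_congr_ae (Filter.Eventually.of_forall fun x => ?_)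
    simp only [hGeq]
    rw [hsymm x y, smul_mul_assoc, mul_comm (ψ y)]
  calc _ = ∫ x, φ x • cutoffPotential ψ x := by
        refine (SchwartzMap.toTemperedDistributionCLM_apply_apply volume _ _).trans ?_
        refine integral_congr_ae (Filter.Eventually.of_forall fun x => ?_)
        exact mul_comm _ _
    _ = ∫ x, ∫ y, G (x - y) • (ψ y * φ x) := by simp only [hL]
    _ = ∫ y, ∫ x, G (x - y) • (ψ y * φ x) := integral_integral_swap hprod
    _ = ∫ y, potential φ y * ψ y := by simp only [hR]
    _ = _ := by
        rw [setIntegral_eq_integral_of_forall_compl_eq_zero]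
        intro x hx
        rw [hzero ψ x hx, mul_zero]

/-- `u ∈ H̃^{-1/2}(-1, 1)` solves `S₀ u = g` on `(-1, 1)`, as an equality of distributions. -/
def IsSolution (u : 𝓢'(ℝ, ℂ)) (g : ℝ → ℂ) : Prop :=
  u ∈ HTilde (-1 / 2) ∧
    ∀ φ : 𝓓(segmentInterior, ℂ), singleLayer u φ = ∫ x in Set.Ioo (-1 : ℝ) 1, g x * φ x

/-- The distribution `u` is the function equal to `f` on `(-1, 1)` and to `0` elsewhere, where `f`
is integrable on `(-1, 1)`. -/
def IsRepresentedBy (u : 𝓢'(ℝ, ℂ)) (f : ℝ → ℂ) : Prop :=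
  IntegrableOn f (Set.Ioo (-1) 1) ∧ ∀ φ : 𝓢(ℝ, ℂ), u φ = ∫ x in Set.Ioo (-1 : ℝ) 1, f x * φ x

end FlatScreen

end

/-! Existence is diagonalisation. With `x = cos θ` the measure `dx/√(1 - x²)` becomes `dθ`, and `log
|cos θ - cos φ|` splits into `log 2` plus the logarithms of `|sin ((θ ± φ)/2)|`. Hence the densities
`Tₙ/√(1 - x²)` are carried to multiples of the Chebyshev polynomials `Tₙ`, with the nonzero factors
`layerEigenvalue n` (`integral_cos_mul_greenKernel`). For smooth `g` the function `g (cos θ)` is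
smooth and periodic, so `g` has a Chebyshev series with rapidly decreasing coefficients. Dividing by
the eigenvalues costs one power of `n`, and since the derivatives of `Tₙ` grow only polynomially in
`n`, the new series has a smooth sum `α` on the closed segment. The density `α/√(1 - x²)` lies in
`H^{-1/2}` because its Fourier transform, an oscillatory integral with phase proportional to `cos
θ`, decays like a power (`exists_norm_fourier_weighted_le`).

Uniqueness is the injectivity of `S₀`. If `S₀ u = 0`, a multiple of the equilibrium density `1/√(1 -
x²)` is subtracted to give `u` mean zero; as `S₀` of that density is constant, `S₀ u` becomes a
constant. An element of `H^{-1}` supported in `[-1, 1]` with mean zero is `-v'` with `v` in `L²`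
supported in `[-1, 1]` (`exists_L2_primitive`). The derivative of the potential is a Hilbert
transform, so the Hilbert transform of `v` is constant on `(-1, 1)`.

Write `v = f₊ + f₋` with spectra in the two half-lines. Then `f₊ - f₋ = κ` on `(-1, 1)` and `v = 0`
outside, so `(f₊ + f₋)(f₊ - f₋ - κ) = 0` everywhere, that is `f₊² - κ f₊ = f₋² + κ f₋`. The two
sides have disjoint spectra, hence both vanish (`quadratic_eq_zero`). On `(-1, 1)` this gives `f₊ f₋
= 0` and `v² = κ²`. For real `v` the constant `κ` is purely imaginary, so `v = 0`. Square
integrability is essential: `1/√(1 - x²)` itself has vanishing Hilbert transform on `(-1, 1)` but is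
not in `L²`. Finally `u` is a multiple of the equilibrium density, and the multiple is zero because
its potential `log 2 / 2` is not. -/

namespace FlatScreen

/-! ### Logarithmic integrals and the Chebyshev eigenfunctions -/

theorem hasDerivAt_sin_mul_log_sin (n : ℕ) {s : ℝ} (hs : s ∈ Set.Ioo 0 Real.pi) :
    HasDerivAt (fun s : ℝ => Real.sin (2 * n * s) * Real.log (Real.sin s))
      (2 * n * (Real.cos (2 * n * s) * Real.log (Real.sin s)) +
        Real.sin (2 * n * s) * (Real.cos s / Real.sin s)) s := by
  have h0 := (Real.sin_pos_of_pos_of_lt_pi hs.1 hs.2).ne'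
  have h1 : HasDerivAt (fun s : ℝ => Real.sin (2 * n * s)) (Real.cos (2 * n * s) * (2 * n)) s := by
    simpa using ((hasDerivAt_id s).const_mul (2 * (n : ℝ))).sin
  convert! h1.mul ((Real.hasDerivAt_sin s).log h0) using 1
  ring

theorem sin_two_mul_nat_mul (n : ℕ) (s : ℝ) :
    Real.sin (2 * n * s) = Real.sin s * (2 * Real.cos s *
      (Polynomial.Chebyshev.U ℝ (n - 1 : ℤ)).eval (Real.cos (2 * s))) := by
  have := Polynomial.Chebyshev.U_real_cos (2 * s) (n - 1 : ℤ)
  push_cast at this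
  rw [show 2 * n * s = (n - 1 + 1 : ℝ) * (2 * s) by ring, ← this, Real.sin_two_mul]
  ring

/-- The factor `sin s` contained in `sin (2ns)` absorbs the singularity of the logarithm, since `t
log t` is continuous. This allows integration by parts up to the endpoints. -/
theorem continuous_sin_mul_log_sin (n : ℕ) :
    Continuous (fun s : ℝ => Real.sin (2 * n * s) * Real.log (Real.sin s)) := by
  have h : (fun s : ℝ => Real.sin (2 * n * s) * Real.log (Real.sin s)) = fun s =>
      (2 * Real.cos s * (Polynomial.Chebyshev.U ℝ (n - 1 : ℤ)).eval (Real.cos (2 * s))) *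
        (Real.sin s * Real.log (Real.sin s)) := by
    funext s
    rw [sin_two_mul_nat_mul]
    ring
  rw [h]
  refine Continuous.mul ?_ (Real.continuous_mul_log.comp Real.continuous_sin)
  have := (Polynomial.Chebyshev.U ℝ (n - 1 : ℤ)).continuous
  fun_prop

theorem sin_mul_cot_eq (n : ℕ) {s : ℝ} (hs : Real.sin s ≠ 0) :
    Real.sin (2 * n * s) * (Real.cos s / Real.sin s) =
      2 * Real.cos s ^ 2 * (Polynomial.Chebyshev.U ℝ (n - 1 : ℤ)).eval (Real.cos (2 * s)) := by
  rw [sin_two_mul_nat_mul]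
  field_simp

theorem integral_cos_even_mul (n : ℕ) (hn : n ≠ 0) :
    ∫ s in (0 : ℝ)..Real.pi, Real.cos (2 * n * s) = 0 := by
  have : (2 * n : ℝ) ≠ 0 := by positivity
  rw [intervalIntegral.integral_comp_mul_left (fun x => Real.cos x) this, integral_cos]
  have := Real.sin_nat_mul_pi (2 * n)
  push_cast at this
  simp [this]

/-- The integrand is `sin (2(n+1)s) cot s` written without a singularity. Consecutive integrands
differ by `cos (2(n+2)s) + cos (2(n+1)s)`, which has integral zero, so the value is that of `∫ 2
cos² s`. -/
theorem integral_dirichlet (n : ℕ) : ∫ s in (0 : ℝ)..Real.pi, 2 * Real.cos s ^ 2 *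
    (Polynomial.Chebyshev.U ℝ (n : ℤ)).eval (Real.cos (2 * s)) = Real.pi := by
  induction n with
  | zero =>
    simp
    ring
  | succ n ih =>
    have hc (m : ℤ) : Continuous fun s : ℝ => 2 * Real.cos s ^ 2 *
        (Polynomial.Chebyshev.U ℝ m).eval (Real.cos (2 * s)) := by
      have := (Polynomial.Chebyshev.U ℝ m).continuous
      fun_prop
    rw [← sub_eq_zero]
    nth_rw 2 [← ih]
    rw [← intervalIntegral.integral_sub ((hc _).intervalIntegrable _ _)
      ((hc _).intervalIntegrable _ _)]
    have key : ∀ s : ℝ, Real.sin s * Real.cos s ≠ 0 → 2 * Real.cos s ^ 2 *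
        (Polynomial.Chebyshev.U ℝ ((n + 1 : ℕ) : ℤ)).eval (Real.cos (2 * s)) -
        2 * Real.cos s ^ 2 * (Polynomial.Chebyshev.U ℝ (n : ℤ)).eval (Real.cos (2 * s)) =
        Real.cos (2 * (n + 2 : ℕ) * s) + Real.cos (2 * (n + 1 : ℕ) * s) := by
      intro s hs
      have h1 := Polynomial.Chebyshev.U_real_cos (2 * s) ((n + 1 : ℕ) : ℤ)
      have h2 := Polynomial.Chebyshev.U_real_cos (2 * s) (n : ℤ)
      have hs2 : Real.sin (2 * s) ≠ 0 := by
        rw [Real.sin_two_mul, mul_assoc]; simpa using hs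
      rw [← eq_div_iff hs2] at h1 h2
      rw [h1, h2]
      set A : ℝ := (2 * n + 3) * s with hA
      have e1 : ((((n + 1 : ℕ) : ℤ) : ℝ) + 1) * (2 * s) = A + s := by push_cast; rw [hA]; ring
      have e2 : (((n : ℤ) : ℝ) + 1) * (2 * s) = A - s := by push_cast; rw [hA]; ring
      have e3 : 2 * ((n + 2 : ℕ) : ℝ) * s = A + s := by push_cast; rw [hA]; ring
      have e4 : 2 * ((n + 1 : ℕ) : ℝ) * s = A - s := by push_cast; rw [hA]; ring
      rw [e1, e2, e3, e4, Real.sin_add, Real.sin_sub, Real.cos_add, Real.cos_sub,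
        Real.sin_two_mul]
      have hs0 : Real.sin s ≠ 0 := left_ne_zero_of_mul hs
      have hc0 : Real.cos s ≠ 0 := right_ne_zero_of_mul hs
      field_simp
      ring
    have hzero : {s : ℝ | Real.sin s * Real.cos s = 0}.Countable := by
      refine (Set.countable_range fun k : ℤ => (k : ℝ) * Real.pi / 2).mono fun s hs => ?_
      have : Real.sin (2 * s) = 0 := by
        rw [Real.sin_two_mul, mul_assoc, hs, mul_zero]
      obtain ⟨k, hk⟩ := Real.sin_eq_zero_iff.1 this
      exact ⟨k, by simp only; linarith⟩
    rw [intervalIntegral.integral_congr_ae (g := fun s => Real.cos (2 * (n + 2 : ℕ) * s) +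
      Real.cos (2 * (n + 1 : ℕ) * s))]
    · rw [intervalIntegral.integral_add, integral_cos_even_mul _ (by omega),
        integral_cos_even_mul _ (by omega), add_zero]
      all_goals exact (by fun_prop : Continuous _).intervalIntegrable _ _
    · filter_upwards [hzero.ae_notMem volume] with s hs _
      exact key s hs

/-- Integration by parts: `sin (2ns) log (sin s)` vanishes at both ends, so `2n` times the integral
is minus the integral of `sin (2ns) cot s`, which is `π`. -/
theorem integral_cos_mul_log_sin (n : ℕ) (hn : n ≠ 0) :
    ∫ s in (0 : ℝ)..Real.pi, Real.cos (2 * n * s) * Real.log (Real.sin s) =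
      -(Real.pi / (2 * n)) := by
  have hi1 : IntervalIntegrable (fun s => Real.cos (2 * n * s) * Real.log (Real.sin s))
      volume 0 Real.pi :=
    intervalIntegrable_log_sin.continuousOn_mul (by fun_prop)
  have hcont : Continuous fun s : ℝ => 2 * Real.cos s ^ 2 *
      (Polynomial.Chebyshev.U ℝ (n - 1 : ℤ)).eval (Real.cos (2 * s)) := by
    have := (Polynomial.Chebyshev.U ℝ (n - 1 : ℤ)).continuous
    fun_prop
  have key := intervalIntegral.integral_eq_sub_of_hasDerivAt_of_le Real.pi_pos.le
    (continuous_sin_mul_log_sin n).continuousOn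
    (f' := fun s => 2 * n * (Real.cos (2 * n * s) * Real.log (Real.sin s)) + 2 * Real.cos s ^ 2 *
      (Polynomial.Chebyshev.U ℝ (n - 1 : ℤ)).eval (Real.cos (2 * s)))
    (fun s hs => by
      have := hasDerivAt_sin_mul_log_sin n hs
      rwa [sin_mul_cot_eq n (Real.sin_pos_of_pos_of_lt_pi hs.1 hs.2).ne'] at this)
    ((hi1.const_mul _).add (hcont.intervalIntegrable _ _))
  rw [intervalIntegral.integral_add (hi1.const_mul _) (hcont.intervalIntegrable _ _),
    intervalIntegral.integral_const_mul] at key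
  obtain ⟨m, rfl⟩ := Nat.exists_eq_succ_of_ne_zero hn
  have hd := integral_dirichlet m
  rw [show (((m.succ : ℕ) : ℤ) - 1) = (m : ℤ) by push_cast; ring, hd] at key
  simp only [Real.sin_pi, Real.sin_zero, Real.log_zero, mul_zero, sub_zero] at key
  have : (2 * (m.succ : ℕ) : ℝ) ≠ 0 := by positivity
  rw [← neg_div, eq_div_iff this]
  linarith


theorem intervalIntegrable_log_of_analytic {f : ℝ → ℝ} (hf : ∀ x, AnalyticAt ℝ f x) (a b : ℝ) :
    IntervalIntegrable (fun x => Real.log (f x)) volume a b :=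
  MeromorphicOn.intervalIntegrable_log fun x _ => (hf x).meromorphicAt

theorem intervalIntegrable_log_sin_half_add (φ a b : ℝ) :
    IntervalIntegrable (fun θ => Real.log (Real.sin ((θ + φ) / 2))) volume a b :=
  intervalIntegrable_log_of_analytic (fun x => by fun_prop) a b

/-- No absolute values are needed on the right because `Real.log` is even. -/
theorem log_cos_sub_cos {θ φ : ℝ} (h1 : Real.sin ((θ + φ) / 2) ≠ 0)
    (h2 : Real.sin ((θ - φ) / 2) ≠ 0) :
    Real.log |Real.cos θ - Real.cos φ| =
      Real.log 2 + Real.log (Real.sin ((θ + φ) / 2)) + Real.log (Real.sin ((θ - φ) / 2)) := by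
  rw [Real.cos_sub_cos, Real.log_abs, Real.log_mul (by simpa using h1) h2,
    Real.log_mul (by norm_num) h1, Real.log_neg_eq_log]

theorem integral_sin_mul_log_sin (n : ℕ) :
    ∫ s in (0 : ℝ)..Real.pi, Real.sin (2 * n * s) * Real.log (Real.sin s) = 0 := by
  have h := intervalIntegral.integral_comp_sub_left
    (fun s => Real.sin (2 * n * s) * Real.log (Real.sin s)) Real.pi (a := 0) (b := Real.pi)
  have e : ∀ s, Real.sin (2 * n * (Real.pi - s)) * Real.log (Real.sin (Real.pi - s)) =
      -(Real.sin (2 * n * s) * Real.log (Real.sin s)) := by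
    intro s
    rw [Real.sin_pi_sub, show 2 * n * (Real.pi - s) = n * (2 * Real.pi) - 2 * n * s by ring,
      Real.sin_nat_mul_two_pi_sub]
    ring
  simp only [e, sub_self, sub_zero, intervalIntegral.integral_neg] at h
  linarith

/-- After `s = (θ + φ)/2` the integrand has period `π`, so the window of integration can be moved
back to `[0, π]`. Expanding `cos (2ns - nφ)` leaves a sine term, odd under `s ↦ π - s`, which drops
out. -/
theorem integral_cos_mul_log_sin_half (n : ℕ) (φ : ℝ) :
    ∫ θ in (-Real.pi)..Real.pi, Real.cos (n * θ) * Real.log (Real.sin ((θ + φ) / 2)) =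
      2 * Real.cos (n * φ) *
        ∫ s in (0 : ℝ)..Real.pi, Real.cos (2 * n * s) * Real.log (Real.sin s) := by
  set F : ℝ → ℝ := fun s => Real.cos (2 * n * s - n * φ) * Real.log (Real.sin s) with hF
  have hper : Function.Periodic F Real.pi := by
    intro s
    simp only [hF]
    rw [Real.sin_add_pi, Real.log_neg_eq_log,
      show 2 * n * (s + Real.pi) - n * φ = 2 * n * s - n * φ + n * (2 * Real.pi) by ring,
      Real.cos_add_nat_mul_two_pi]
  have h1 : ∀ θ, Real.cos (n * θ) * Real.log (Real.sin ((θ + φ) / 2)) = F (θ / 2 + φ / 2) := by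
    intro θ
    simp only [hF]
    congr 2 <;> ring_nf
  simp only [h1]
  rw [intervalIntegral.integral_comp_div_add _ two_ne_zero,
    show Real.pi / 2 + φ / 2 = -Real.pi / 2 + φ / 2 + Real.pi by ring,
    hper.intervalIntegral_add_eq _ 0, zero_add]
  have h2 : ∀ s, F s = Real.cos (n * φ) * (Real.cos (2 * n * s) * Real.log (Real.sin s)) +
      Real.sin (n * φ) * (Real.sin (2 * n * s) * Real.log (Real.sin s)) := by
    intro s
    simp only [hF]
    rw [Real.cos_sub]
    ring
  have hi (f : ℝ → ℝ) (hf : Continuous f) :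
      IntervalIntegrable (fun s => f s * Real.log (Real.sin s)) volume 0 Real.pi :=
    intervalIntegrable_log_sin.continuousOn_mul hf.continuousOn
  simp only [h2]
  rw [intervalIntegral.integral_add ((hi _ (by fun_prop)).const_mul _)
    ((hi _ (by fun_prop)).const_mul _), intervalIntegral.integral_const_mul,
    intervalIntegral.integral_const_mul, integral_sin_mul_log_sin, smul_eq_mul]
  ring

theorem ae_sin_half_ne_zero (φ : ℝ) : ∀ᵐ θ : ℝ, Real.sin ((θ + φ) / 2) ≠ 0 := by
  have : {θ : ℝ | Real.sin ((θ + φ) / 2) = 0}.Countable := by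
    refine (Set.countable_range fun k : ℤ => 2 * ((k : ℝ) * Real.pi) - φ).mono fun s hs => ?_
    obtain ⟨k, hk⟩ := Real.sin_eq_zero_iff.1 hs
    exact ⟨k, by simp only; linarith⟩
  exact this.ae_notMem volume

theorem intervalIntegrable_log_cos_sub (y a b : ℝ) :
    IntervalIntegrable (fun θ => Real.log |Real.cos θ - y|) volume a b := by
  simp only [Real.log_abs]
  exact intervalIntegrable_log_of_analytic (fun x => by fun_prop) a b

theorem integral_cos_mul_log_cos_sub_cos (n : ℕ) (φ : ℝ) :
    ∫ θ in (0 : ℝ)..Real.pi, Real.cos (n * θ) * Real.log |Real.cos θ - Real.cos φ| =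
      Real.log 2 * (∫ θ in (0 : ℝ)..Real.pi, Real.cos (n * θ)) + 2 * Real.cos (n * φ) *
        ∫ s in (0 : ℝ)..Real.pi, Real.cos (2 * n * s) * Real.log (Real.sin s) := by
  have hi (φ a b : ℝ) : IntervalIntegrable
      (fun θ => Real.cos (n * θ) * Real.log (Real.sin ((θ + φ) / 2))) volume a b :=
    (intervalIntegrable_log_sin_half_add φ a b).continuousOn_mul (by fun_prop)
  -- Reflection moves the term with `-φ` to `[-π, 0]`, so the two logarithms together make one
  -- integral over a full period.
  have hrefl : ∫ θ in (0 : ℝ)..Real.pi, Real.cos (n * θ) * Real.log (Real.sin ((θ + -φ) / 2)) =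
      ∫ θ in (-Real.pi)..0, Real.cos (n * θ) * Real.log (Real.sin ((θ + φ) / 2)) := by
    have := intervalIntegral.integral_comp_neg (a := 0) (b := Real.pi)
      fun θ => Real.cos (n * θ) * Real.log (Real.sin ((θ + φ) / 2))
    rw [neg_zero] at this
    rw [← this]
    refine intervalIntegral.integral_congr fun θ _ => ?_
    rw [mul_neg, Real.cos_neg, show (-θ + φ) / 2 = -((θ + -φ) / 2) by ring, Real.sin_neg,
      Real.log_neg_eq_log]
  rw [← integral_cos_mul_log_sin_half, ← intervalIntegral.integral_add_adjacent_intervals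
    (hi φ (-Real.pi) 0) (hi φ 0 Real.pi), ← hrefl, ← intervalIntegral.integral_const_mul,
    ← intervalIntegral.integral_add (hi _ _ _) (hi _ _ _), ← intervalIntegral.integral_add
      ((by fun_prop : Continuous _).intervalIntegrable _ _) ((hi _ _ _).add (hi _ _ _))]
  refine intervalIntegral.integral_congr_ae ?_
  filter_upwards [ae_sin_half_ne_zero φ, ae_sin_half_ne_zero (-φ)] with θ h1 h2 _
  rw [log_cos_sub_cos h1 (by rwa [sub_eq_add_neg]), ← sub_eq_add_neg]
  ring

/-- The eigenvalues of the single-layer operator on the segment: `S₀ (Tₙ w) = layerEigenvalue n Tₙ`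
for the Chebyshev weight `w`. -/
noncomputable def layerEigenvalue (n : ℤ) : ℝ := if n = 0 then Real.log 2 / 2 else 1 / (2 * |(n : ℝ)|)

theorem layerEigenvalue_pos (n : ℤ) : 0 < layerEigenvalue n := by
  unfold layerEigenvalue
  split_ifs with h
  · have := Real.log_pos one_lt_two
    positivity
  · have : 0 < |(n : ℝ)| := by positivity
    positivity

/-- For `n = 0` the contributions `π log 2` and `-2π log 2` add up to `-π log 2`. For `n ≠ 0` the
cosine has mean zero and only `-π/(2n)` contributes. The factor `-1/(2π)` then gives the eigenvalue.
-/
theorem integral_cos_mul_greenKernel (n : ℤ) {y : ℝ} (hy : y ∈ Set.Icc (-1 : ℝ) 1) :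
    ∫ θ in (0 : ℝ)..Real.pi, Real.cos (n * θ) * greenKernel (Real.cos θ - y) =
      layerEigenvalue n * (Polynomial.Chebyshev.T ℝ n).eval y := by
  wlog hn : 0 ≤ n generalizing n
  · have := this (-n) (by omega)
    simpa [layerEigenvalue, Polynomial.Chebyshev.T_neg] using this
  lift n to ℕ using hn
  obtain ⟨φ, rfl⟩ : ∃ φ, Real.cos φ = y := ⟨_, Real.cos_arccos hy.1 hy.2⟩
  have h := integral_cos_mul_log_cos_sub_cos n φ
  have e : ∀ θ, Real.cos (n * θ) * greenKernel (Real.cos θ - Real.cos φ) = -(1 / (2 * Real.pi)) *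
      (Real.cos (n * θ) * Real.log |Real.cos θ - Real.cos φ|) := fun θ => by
    rw [greenKernel]; ring
  rw [Polynomial.Chebyshev.T_real_cos]
  simp only [Int.cast_natCast, e]
  rw [intervalIntegral.integral_const_mul, h]
  have hpi := Real.pi_ne_zero
  by_cases hn : n = 0
  · subst hn
    simp [layerEigenvalue, integral_log_sin_zero_pi]
    field_simp
    ring
  · have h0 : (n : ℝ) ≠ 0 := by exact_mod_cast hn
    rw [integral_cos_mul_log_sin n hn, intervalIntegral.integral_comp_mul_left _ h0, integral_cos]
    simp [layerEigenvalue, hn, Real.sin_nat_mul_pi]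
    field_simp

end FlatScreen

/-! ### Derivative bounds and smoothness of Chebyshev series -/

namespace FlatScreen

open Polynomial in
-- The recursion `U_{n+2} = U_n + 2 T_{n+2}` sums the bounds for `T` into one for `U`. It is the
-- half-step of an induction on `k` that closes through `T_n' = n U_{n-1}`.
theorem abs_iterate_derivative_U_le {k : ℕ}
    (hT : ∀ n : ℕ, ∀ x ∈ Set.Icc (-1 : ℝ) 1,
      |(derivative^[k] (Chebyshev.T ℝ n)).eval x| ≤ (n : ℝ) ^ (2 * k))
    (n : ℕ) {x : ℝ} (hx : x ∈ Set.Icc (-1 : ℝ) 1) :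
    |(derivative^[k] (Chebyshev.U ℝ n)).eval x| ≤ (n + 1) * (n : ℝ) ^ (2 * k) := by
  induction n using Nat.strong_induction_on with
  | _ n ih =>
    match n with
    | 0 =>
      rcases k with _ | k <;> simp [iterate_derivative_one]
    | 1 =>
      have h := hT 1 x hx
      simp only [Nat.cast_one, Chebyshev.T_one, one_pow, mul_one, Chebyshev.U_one] at h ⊢
      rw [show (2 * X : ℝ[X]) = C 2 * X by simp [← C_ofNat], iterate_derivative_C_mul, eval_C_mul,
        abs_mul]
      norm_num
      exact h
    | n + 2 =>
      have h0 := ih n (by omega)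
      have h2 := hT (n + 2) x hx
      have e : Chebyshev.U ℝ ((n + 2 : ℕ) : ℤ) =
          Chebyshev.U ℝ (n : ℤ) + C 2 * Chebyshev.T ℝ ((n + 2 : ℕ) : ℤ) := by
        have h1 := Chebyshev.T_eq_U_sub_X_mul_U ℝ ((n + 2 : ℕ) : ℤ)
        have h3 := Chebyshev.U_add_two ℝ (n : ℤ)
        push_cast at h1 h3 ⊢
        rw [show (n : ℤ) + 2 - 1 = n + 1 by ring] at h1
        rw [h1, show (C 2 : ℝ[X]) = 2 from map_ofNat C 2]
        linear_combination -h3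
      rw [e, iterate_map_add, iterate_derivative_C_mul, eval_add, eval_C_mul]
      have h4 : (n : ℝ) ^ (2 * k) ≤ ((n + 2 : ℕ) : ℝ) ^ (2 * k) := by
        gcongr
        omega
      calc _ ≤ |(derivative^[k] (Chebyshev.U ℝ n)).eval x| +
            |2 * (derivative^[k] (Chebyshev.T ℝ ((n + 2 : ℕ) : ℤ))).eval x| := abs_add_le _ _
        _ ≤ (n + 1) * ((n + 2 : ℕ) : ℝ) ^ (2 * k) + 2 * ((n + 2 : ℕ) : ℝ) ^ (2 * k) := by
            rw [abs_mul, abs_two]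
            gcongr
            exact h0.trans (by gcongr)
        _ = _ := by push_cast; ring

open Polynomial in
theorem abs_iterate_derivative_T_nat_le (k n : ℕ) {x : ℝ} (hx : x ∈ Set.Icc (-1 : ℝ) 1) :
    |(derivative^[k] (Chebyshev.T ℝ n)).eval x| ≤ (n : ℝ) ^ (2 * k) := by
  induction k generalizing n x with
  | zero => simpa using Chebyshev.abs_eval_T_real_le_one n (abs_le.2 hx)
  | succ k ih =>
    rcases n with _ | n
    · simp
    · have hU := abs_iterate_derivative_U_le (fun n x hx => ih n hx) n hx
      rw [Function.iterate_succ_apply, Chebyshev.T_derivative_eq_U]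
      have e : ((((n + 1 : ℕ) : ℤ) : ℝ[X]) * Chebyshev.U ℝ (((n + 1 : ℕ) : ℤ) - 1)) =
          C ((n + 1 : ℕ) : ℝ) * Chebyshev.U ℝ (n : ℤ) := by
        push_cast
        simp
      rw [e, iterate_derivative_C_mul, eval_C_mul, abs_mul, Nat.abs_cast]
      calc _ ≤ ((n + 1 : ℕ) : ℝ) * ((n + 1) * (n : ℝ) ^ (2 * k)) := by gcongr
        _ ≤ ((n + 1 : ℕ) : ℝ) * ((n + 1) * ((n + 1 : ℕ) : ℝ) ^ (2 * k)) := by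
            gcongr
            omega
        _ = _ := by push_cast; ring

open Polynomial in
/-- A bound of Markov type for the derivatives of the Chebyshev polynomials. -/
theorem abs_iterate_derivative_T_le (k : ℕ) (n : ℤ) {x : ℝ} (hx : x ∈ Set.Icc (-1 : ℝ) 1) :
    |(derivative^[k] (Chebyshev.T ℝ n)).eval x| ≤ |(n : ℝ)| ^ (2 * k) := by
  rw [← Chebyshev.T_natAbs, ← Int.cast_abs, Int.abs_eq_natAbs, Int.cast_natCast]
  exact abs_iterate_derivative_T_nat_le k _ hx

open Polynomial in
/-- The `k`-th derivative of the Chebyshev series with coefficients `c`. -/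
noncomputable def chebyshevSeries (c : ℤ → ℂ) (k : ℕ) (x : ℝ) : ℂ :=
  ∑' n, c n * (((derivative^[k] (Chebyshev.T ℝ n)).eval x : ℝ) : ℂ)

open Polynomial in
theorem norm_chebyshevSeries_term_le (c : ℤ → ℂ) (k : ℕ) (n : ℤ) {x : ℝ}
    (hx : x ∈ Set.Icc (-1 : ℝ) 1) :
    ‖c n * (((derivative^[k] (Chebyshev.T ℝ n)).eval x : ℝ) : ℂ)‖ ≤
      |(n : ℝ)| ^ (2 * k) * ‖c n‖ := by
  rw [norm_mul, Complex.norm_real, mul_comm]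
  gcongr
  exact abs_iterate_derivative_T_le k n hx

variable {c : ℤ → ℂ}

open Polynomial in
theorem summable_chebyshevSeries (hc : ∀ k : ℕ, Summable fun n : ℤ => |(n : ℝ)| ^ k * ‖c n‖)
    (k : ℕ) {x : ℝ} (hx : x ∈ Set.Icc (-1 : ℝ) 1) :
    Summable fun n => c n * (((derivative^[k] (Chebyshev.T ℝ n)).eval x : ℝ) : ℂ) :=
  Summable.of_norm_bounded (hc (2 * k)) fun n => norm_chebyshevSeries_term_le c k n hx

theorem continuousOn_chebyshevSeries
    (hc : ∀ k : ℕ, Summable fun n : ℤ => |(n : ℝ)| ^ k * ‖c n‖) (k : ℕ) :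
    ContinuousOn (chebyshevSeries c k) (Set.Icc (-1) 1) :=
  continuousOn_tsum (fun n => by fun_prop) (hc (2 * k))
    fun n _ hx => norm_chebyshevSeries_term_le c k n hx

open Polynomial in
-- Termwise integration, rather than termwise differentiation, so that the endpoints of the closed
-- segment need no separate treatment.
theorem chebyshevSeries_eq_add_integral
    (hc : ∀ k : ℕ, Summable fun n : ℤ => |(n : ℝ)| ^ k * ‖c n‖) (k : ℕ) {x : ℝ}
    (hx : x ∈ Set.Icc (-1 : ℝ) 1) :
    chebyshevSeries c k x =
      chebyshevSeries c k (-1) + ∫ t in (-1 : ℝ)..x, chebyshevSeries c (k + 1) t := by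
  have hsub : Set.uIcc (-1) x ⊆ Set.Icc (-1 : ℝ) 1 := by
    rw [Set.uIcc_of_le hx.1]
    exact Set.Icc_subset_Icc_right hx.2
  let f : ℤ → C(ℝ, ℂ) := fun n =>
    ⟨fun t => c n * (((derivative^[k + 1] (Chebyshev.T ℝ n)).eval t : ℝ) : ℂ), by fun_prop⟩
  have h := intervalIntegral.hasSum_intervalIntegral_of_summable_norm (a := -1) (b := x) (f := f)
    (Summable.of_nonneg_of_le (fun _ => norm_nonneg _) (fun n => by
      rw [ContinuousMap.norm_le _ (by positivity)]
      exact fun t => norm_chebyshevSeries_term_le c (k + 1) n (hsub t.2)) (hc (2 * (k + 1))))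
  have h1 : ∀ n, ∫ t in (-1 : ℝ)..x, f n t =
      c n * (((derivative^[k] (Chebyshev.T ℝ n)).eval x : ℝ) : ℂ) -
      c n * (((derivative^[k] (Chebyshev.T ℝ n)).eval (-1) : ℝ) : ℂ) := by
    intro n
    refine intervalIntegral.integral_eq_sub_of_hasDerivAt
      (f := fun t : ℝ => c n * (((derivative^[k] (Chebyshev.T ℝ n)).eval t : ℝ) : ℂ))
      (fun t _ => ?_) ((f n).continuous.intervalIntegrable _ _)
    have := ((derivative^[k] (Chebyshev.T ℝ n)).hasDerivAt t).ofReal_comp.const_mul (c n)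
    simpa [f, Function.iterate_succ_apply'] using! this
  simp only [h1] at h
  have h2 := h.unique ((summable_chebyshevSeries hc k hx).hasSum.sub
    (summable_chebyshevSeries hc k (by simp : (-1 : ℝ) ∈ Set.Icc (-1 : ℝ) 1)).hasSum)
  have h3 : ∫ t in (-1 : ℝ)..x, chebyshevSeries c (k + 1) t = ∫ t in (-1 : ℝ)..x, ∑' n, f n t :=
    rfl
  rw [h3, h2]
  simp only [chebyshevSeries]
  ring

theorem hasDerivWithinAt_chebyshevSeries
    (hc : ∀ k : ℕ, Summable fun n : ℤ => |(n : ℝ)| ^ k * ‖c n‖) (k : ℕ) {x : ℝ}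
    (hx : x ∈ Set.Icc (-1 : ℝ) 1) :
    HasDerivWithinAt (chebyshevSeries c k) (chebyshevSeries c (k + 1) x) (Set.Icc (-1) 1) x := by
  -- The one-sided fundamental theorem of calculus within `[-1, 1]` takes its filter instance from
  -- this fact.
  have : Fact (x ∈ Set.Icc (-1 : ℝ) 1) := ⟨hx⟩
  have hcont := continuousOn_chebyshevSeries hc (k + 1)
  have h := intervalIntegral.integral_hasDerivWithinAt_right (a := -1) (b := x)
    (s := Set.Icc (-1) 1) (t := Set.Icc (-1) 1) (f := chebyshevSeries c (k + 1))
    ((hcont.mono (by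
      rw [Set.uIcc_of_le hx.1]
      exact Set.Icc_subset_Icc_right hx.2)).intervalIntegrable)
    (hcont.stronglyMeasurableAtFilter_nhdsWithin measurableSet_Icc x) (hcont x hx)
  refine (h.const_add (chebyshevSeries c k (-1))).congr_of_mem (fun y hy => ?_) hx
  exact chebyshevSeries_eq_add_integral hc k hy

/-- A Chebyshev series with rapidly decreasing coefficients is smooth on the closed segment. -/
theorem contDiffOn_chebyshevSeries
    (hc : ∀ k : ℕ, Summable fun n : ℤ => |(n : ℝ)| ^ k * ‖c n‖) (k : ℕ) :
    ContDiffOn ℝ ∞ (chebyshevSeries c k) (Set.Icc (-1) 1) := by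
  have hu : UniqueDiffOn ℝ (Set.Icc (-1 : ℝ) 1) := uniqueDiffOn_Icc (by norm_num)
  rw [contDiffOn_infty]
  intro m
  induction m generalizing k with
  | zero => exact contDiffOn_zero.2 (continuousOn_chebyshevSeries hc k)
  | succ m ih =>
    push_cast
    rw [contDiffOn_succ_iff_derivWithin hu]
    refine ⟨fun x hx => (hasDerivWithinAt_chebyshevSeries hc k hx).differentiableWithinAt,
      by simp, (ih (k + 1)).congr fun x hx => ?_⟩
    exact (hasDerivWithinAt_chebyshevSeries hc k hx).derivWithin (hu x hx)

end FlatScreen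

/-! ### Rapid decay of Fourier coefficients and the Chebyshev expansion -/

namespace FlatScreen

/-- Each integration by parts gains a factor `1/|n|`; the boundary terms cancel by periodicity. -/
theorem exists_norm_fourierCoeffOn_mul_le (k : ℕ) {h : ℝ → ℂ} (hh : ContDiff ℝ ∞ h)
    (hper : Function.Periodic h (2 * Real.pi)) :
    ∃ C : ℝ, ∀ n : ℤ, |(n : ℝ)| ^ k * ‖fourierCoeffOn Real.two_pi_pos h n‖ ≤ C := by
  induction k generalizing h with
  | zero =>
    obtain ⟨C, hC⟩ := isCompact_Icc.exists_bound_of_continuousOn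
      (s := Set.Icc 0 (2 * Real.pi)) hh.continuous.continuousOn
    refine ⟨C, fun n => ?_⟩
    rw [pow_zero, one_mul, fourierCoeffOn_eq_integral, norm_smul]
    have : ‖∫ x in (0 : ℝ)..(2 * Real.pi), fourier (-n) (x : AddCircle (2 * Real.pi - 0)) • h x‖ ≤
        C * |2 * Real.pi - 0| := by
      refine intervalIntegral.norm_integral_le_of_norm_le_const fun x hx => ?_
      rw [Set.uIoc_of_le Real.two_pi_pos.le] at hx
      rw [norm_smul, fourier_apply, Circle.norm_coe, one_mul]
      exact hC x ⟨hx.1.le, hx.2⟩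
    rw [sub_zero, abs_of_pos Real.two_pi_pos] at this
    rw [sub_zero, Real.norm_of_nonneg (by positivity), one_div_mul_eq_div,
      div_le_iff₀ Real.two_pi_pos]
    simpa using this
  | succ k ih =>
    have hd : ContDiff ℝ ∞ (deriv h) := (contDiff_infty_iff_deriv.1 hh).2
    have hdper : Function.Periodic (deriv h) (2 * Real.pi) := fun x => by
      rw [← deriv_comp_add_const]
      congr 1
      exact funext hper
    obtain ⟨C, hC⟩ := ih hd hdper
    -- The value `0` covers `n = 0`, where the left side is zero and integration by parts is not
    -- available.
    refine ⟨max C 0, fun n => ?_⟩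
    by_cases hn : n = 0
    · simp [hn]
    refine le_trans (le_of_eq ?_) ((hC n).trans (le_max_left _ _))
    rw [fourierCoeffOn_of_hasDerivAt Real.two_pi_pos hn
      (fun x _ => ((contDiff_infty_iff_deriv.1 hh).1 x).hasDerivAt)
      (hd.continuous.intervalIntegrable _ _)]
    have h0 : h (2 * Real.pi) - h 0 = 0 := by
      rw [sub_eq_zero]
      simpa using hper 0
    have hn' : |(n : ℝ)| ≠ 0 := by simpa using hn
    rw [h0, mul_zero, zero_sub, norm_mul, norm_neg, norm_mul]
    simp [abs_of_pos Real.pi_pos]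
    field_simp
    ring

theorem summable_fourierCoeffOn (k : ℕ) {h : ℝ → ℂ} (hh : ContDiff ℝ ∞ h)
    (hper : Function.Periodic h (2 * Real.pi)) :
    Summable fun n : ℤ => |(n : ℝ)| ^ k * ‖fourierCoeffOn Real.two_pi_pos h n‖ := by
  obtain ⟨C, hC⟩ := exists_norm_fourierCoeffOn_mul_le (k + 2) hh hper
  refine Summable.of_norm_bounded_eventually
    ((Real.summable_one_div_int_pow (p := 2)).2 one_lt_two |>.mul_left C) ?_
  filter_upwards [Filter.eventually_cofinite_ne 0] with n hn
  have hn' : (0 : ℝ) < (n : ℝ) ^ 2 := by positivity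
  rw [Real.norm_of_nonneg (by positivity), mul_one_div, le_div_iff₀ hn']
  refine le_trans (le_of_eq ?_) (hC n)
  rw [pow_add, sq_abs]
  ring

theorem hasSum_fourierCoeffOn_mul_exp {h : ℝ → ℂ} (hh : ContDiff ℝ ∞ h)
    (hper : Function.Periodic h (2 * Real.pi)) (x : ℝ) :
    HasSum (fun n : ℤ => fourierCoeffOn Real.two_pi_pos h n * Complex.exp (n * x * Complex.I))
      (h x) := by
  have : Fact (0 < 2 * Real.pi) := ⟨Real.two_pi_pos⟩
  let F : C(AddCircle (2 * Real.pi), ℂ) :=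
    ⟨hper.lift, continuous_coinduced_dom.2 hh.continuous⟩
  have hF : ∀ n, fourierCoeff F n = fourierCoeffOn Real.two_pi_pos h n := by
    intro n
    rw [fourierCoeff_eq_intervalIntegral F n 0, fourierCoeffOn_eq_integral]
    simp [F, zero_add]
  have hs := summable_fourierCoeffOn 0 hh hper
  simp only [pow_zero, one_mul] at hs
  have := has_pointwise_sum_fourier_series_of_summable (f := F)
    (by rw [funext hF]; exact hs.of_norm) (x : AddCircle (2 * Real.pi))
  simp only [hF] at this
  convert! this using 3 with n
  · rw [fourier_coe_apply]
    congr 1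
    have : (Real.pi : ℂ) ≠ 0 := by exact_mod_cast Real.pi_ne_zero
    push_cast
    field_simp

/-- A smooth function on `[-1, 1]` is the sum of a Chebyshev series with rapidly decreasing
coefficients. -/
theorem exists_chebyshev_expansion {g : ℝ → ℂ} (hg : ContDiffOn ℝ ∞ g (Set.Icc (-1) 1)) :
    ∃ c : ℤ → ℂ, (∀ k : ℕ, Summable fun n : ℤ => |(n : ℝ)| ^ k * ‖c n‖) ∧
      ∀ x ∈ Set.Icc (-1 : ℝ) 1, HasSum
        (fun n => c n * (((Polynomial.Chebyshev.T ℝ n).eval x : ℝ) : ℂ)) (g x) := by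
  have hh : ContDiff ℝ ∞ (fun θ => g (Real.cos θ)) := by
    rw [← contDiffOn_univ]
    exact hg.comp (Real.contDiff_cos.contDiffOn) fun θ _ => Real.cos_mem_Icc θ
  have hper : Function.Periodic (fun θ => g (Real.cos θ)) (2 * Real.pi) := fun θ => by
    simp only [Real.cos_add_two_pi]
  refine ⟨_, fun k => summable_fourierCoeffOn k hh hper, fun x hx => ?_⟩
  -- Averaging the Fourier series at `±arccos x` turns the exponentials into cosines, so the
  -- coefficients need not be shown to be even in `n`.
  have h1 := hasSum_fourierCoeffOn_mul_exp hh hper (Real.arccos x)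
  have h2 := hasSum_fourierCoeffOn_mul_exp hh hper (-Real.arccos x)
  simp only [Real.cos_neg, Real.cos_arccos hx.1 hx.2] at h1 h2
  have h3 := (h1.add h2).div_const 2
  rw [add_self_div_two] at h3
  convert! h3 using 2 with n
  have : (Polynomial.Chebyshev.T ℝ n).eval x = Real.cos (n * Real.arccos x) := by
    rw [← Polynomial.Chebyshev.T_real_cos, Real.cos_arccos hx.1 hx.2]
  rw [this, Complex.ofReal_cos, Complex.cos]
  push_cast
  rw [show -((n : ℂ) * (Real.arccos x : ℂ)) * Complex.I =
    (n : ℂ) * (-(Real.arccos x : ℂ)) * Complex.I by ring]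
  ring

end FlatScreen

/-! ### Integrable densities as distributions -/

namespace FlatScreen

open FourierTransform

/-- The tempered distribution given by an integrable function. -/
noncomputable def ofIntegrable {f : ℝ → ℂ} (hf : Integrable f) : 𝓢'(ℝ, ℂ) :=
  Lp.toTemperedDistribution ((memLp_one_iff_integrable.2 hf).toLp f)

theorem ofIntegrable_apply {f : ℝ → ℂ} (hf : Integrable f) (φ : 𝓢(ℝ, ℂ)) :
    ofIntegrable hf φ = ∫ x, φ x * f x := by
  rw [ofIntegrable, Lp.toTemperedDistribution_apply]
  refine integral_congr_ae ?_
  filter_upwards [(memLp_one_iff_integrable.2 hf).coeFn_toLp] with x hx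
  rw [hx, smul_eq_mul]

theorem integral_fourier_mul_eq {f g : ℝ → ℂ} (hf : Integrable f) (hg : Integrable g) :
    ∫ ξ, 𝓕 f ξ * g ξ = ∫ x, f x * 𝓕 g x := by
  simpa using! VectorFourier.integral_bilin_fourierIntegral_eq_flip (ContinuousLinearMap.mul ℂ ℂ)
    (L := innerₗ ℝ) Real.continuous_fourierChar continuous_inner hf hg

theorem fourier_ofIntegrable_apply {f : ℝ → ℂ} (hf : Integrable f) (φ : 𝓢(ℝ, ℂ)) :
    𝓕 (ofIntegrable hf) φ = ∫ ξ, φ ξ * 𝓕 f ξ := by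
  rw [TemperedDistribution.fourier_apply, ofIntegrable_apply]
  exact integral_fourier_mul_eq φ.integrable hf

theorem continuous_fourier_of_integrable {f : ℝ → ℂ} (hf : Integrable f) : Continuous (𝓕 f) :=
  VectorFourier.fourierIntegral_continuous Real.continuous_fourierChar continuous_inner hf

/-- An integrable function whose Fourier transform decays like a negative power belongs to
`H^{-1/2}`. -/
theorem memSobolev_ofIntegrable {f : ℝ → ℂ} (hf : Integrable f) {C : ℝ}
    (hC : ∀ ξ, ‖𝓕 f ξ‖ ≤ C * (1 + ‖ξ‖ ^ 2) ^ (-(1 / 6) : ℝ)) :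
    MemSobolev (-1 / 2) 2 (ofIntegrable hf) := by
  rw [memSobolev_iff_exists_smulLeftCLM_fourier]
  set w : ℝ → ℂ := fun ξ => (((1 + ‖ξ‖ ^ 2) ^ ((-1 / 2 : ℝ) / 2) : ℝ) : ℂ) with hw
  have hwt : w.HasTemperateGrowth := by
    simp only [hw]
    fun_prop
  have hcont : Continuous fun ξ => w ξ * 𝓕 f ξ :=
    hwt.1.continuous.mul (continuous_fourier_of_integrable hf)
  have hmem : MemLp (fun ξ => w ξ * 𝓕 f ξ) 2 := by
    rw [memLp_two_iff_integrable_sq_norm hcont.aestronglyMeasurable]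
    -- The squared weight contributes the exponent `-1/2` and the squared decay `-1/3`, in total
    -- `-5/6 = -(5/3)/2`; integrability on the line needs `5/3 > 1`.
    have hint := (integrable_rpow_neg_one_add_norm_sq (E := ℝ) (μ := volume) (r := 5 / 3)
      (by norm_num)).const_mul (C ^ 2)
    refine hint.mono' (hcont.norm.pow 2).aestronglyMeasurable (.of_forall fun ξ => ?_)
    have hp : (0 : ℝ) < 1 + ‖ξ‖ ^ 2 := by positivity
    rw [Real.norm_of_nonneg (by positivity), norm_mul, mul_pow]
    calc _ ≤ ((1 + ‖ξ‖ ^ 2) ^ ((-1 / 2 : ℝ) / 2)) ^ 2 *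
          (C * (1 + ‖ξ‖ ^ 2) ^ (-(1 / 6) : ℝ)) ^ 2 := by
          gcongr
          · rw [hw, Complex.norm_real, Real.norm_of_nonneg (by positivity)]
          · exact hC ξ
      _ = C ^ 2 * (1 + ‖ξ‖ ^ 2) ^ (-(5 / 3) / 2 : ℝ) := by
          rw [mul_pow, ← Real.rpow_mul_natCast hp.le, ← Real.rpow_mul_natCast hp.le,
            mul_left_comm, ← Real.rpow_add hp]
          norm_num
  refine ⟨hmem.toLp _, ?_⟩
  ext φ
  rw [Lp.toTemperedDistribution_apply, TemperedDistribution.smulLeftCLM_apply_apply, fourier_ofIntegrable_apply]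
  refine integral_congr_ae ?_
  filter_upwards [hmem.coeFn_toLp] with ξ hξ
  rw [hξ, SchwartzMap.smulLeftCLM_apply_apply hwt]
  simp only [smul_eq_mul]
  ring

theorem dsupport_ofIntegrable_subset {f : ℝ → ℂ} (hf : Integrable f) {s : Set ℝ} (hs : IsClosed s)
    (h0 : ∀ x ∉ s, f x = 0) : Distribution.dsupport (ofIntegrable hf) ⊆ s := by
  refine Set.sInter_subset_of_mem ⟨fun φ hφ => ?_, hs⟩
  rw [ofIntegrable_apply]
  refine integral_eq_zero_of_ae (.of_forall fun x => ?_)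
  by_cases hx : x ∈ s
  · have : φ x = 0 := image_eq_zero_of_notMem_tsupport fun h => hφ h hx
    simp [this]
  · simp [h0 x hx]

theorem cutoff_eq_one {x : ℝ} (hx : x ∈ Set.Icc (-1 : ℝ) 1) : cutoff x = 1 := by
  rw [cutoff.one_of_mem_closedBall]
  rw [Metric.mem_closedBall, dist_zero_right, Real.norm_eq_abs]
  exact (abs_le.mpr hx).trans (by norm_num [cutoff])

theorem cutoffPotential_apply (φ : 𝓓(segmentInterior, ℂ)) {x : ℝ} (hx : x ∈ Set.Icc (-1 : ℝ) 1) :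
    cutoffPotential φ x = potential φ x := by
  change cutoff x • potential φ x = _
  rw [cutoff_eq_one hx, one_smul]

theorem testFunction_eq_zero (φ : 𝓓(segmentInterior, ℂ)) {x : ℝ} (hx : x ∉ Set.Ioo (-1 : ℝ) 1) :
    φ x = 0 :=
  image_eq_zero_of_notMem_tsupport fun h => hx (φ.tsupport_subset h)

theorem greenKernel_sub_comm (x y : ℝ) : greenKernel (x - y) = greenKernel (y - x) := by
  simp only [greenKernel, abs_sub_comm]

/-- Fubini. Points of `(-1, 1)` differ by less than `2`, so the kernel may be truncated to `[-2,
2]`, where it is integrable. -/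
theorem singleLayer_ofIntegrable {f : ℝ → ℂ} (hf : Integrable f)
    (h0 : ∀ x ∉ Set.Ioo (-1 : ℝ) 1, f x = 0) (φ : 𝓓(segmentInterior, ℂ)) :
    singleLayer (ofIntegrable hf) φ =
      ∫ y in Set.Ioo (-1 : ℝ) 1, (∫ x, greenKernel (x - y) • f x) * φ y := by
  set G : ℝ → ℝ := (Set.Icc (-2) 2).indicator greenKernel with hG
  have hGint : Integrable G :=
    (locallyIntegrable_greenKernel.integrableOn_isCompact isCompact_Icc).integrable_indicator
      measurableSet_Icc
  have hprod : Integrable (fun p : ℝ × ℝ => G (p.1 - p.2) • (f p.2 * φ p.1))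
      (volume.prod volume) := by
    have h1 : Integrable (fun p : ℝ × ℝ => G (p.1 - p.2) • f p.2) (volume.prod volume) := by
      simpa using hf.convolution_integrand (ContinuousLinearMap.lsmul ℝ ℝ).flip hGint
    obtain ⟨C, hC⟩ := φ.hasCompactSupport.exists_bound_of_continuous φ.continuous
    have h2 := h1.mul_bdd (c := C) (g := fun p : ℝ × ℝ => φ p.1)
      (φ.continuous.comp continuous_fst).aestronglyMeasurable
      (Filter.Eventually.of_forall fun p => hC p.1)
    simpa [mul_assoc] using h2
  have hGeq : ∀ y x : ℝ, G (y - x) • (f x * φ y) = greenKernel (x - y) • (f x * φ y) := by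
    intro y x
    by_cases hx : x ∈ Set.Ioo (-1 : ℝ) 1
    · by_cases hy : y ∈ Set.Ioo (-1 : ℝ) 1
      · rw [hG, Set.indicator_of_mem, greenKernel_sub_comm]
        exact ⟨by linarith [hx.2, hy.1], by linarith [hx.1, hy.2]⟩
      · simp [testFunction_eq_zero φ hy]
    · simp [h0 x hx]
  have hL : ∀ x : ℝ, cutoffPotential φ x * f x = ∫ y, G (y - x) • (f x * φ y) := by
    intro x
    by_cases hx : x ∈ Set.Ioo (-1 : ℝ) 1
    · rw [cutoffPotential_apply φ (Set.Ioo_subset_Icc_self hx), potential, ← integral_mul_const]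
      refine integral_congr_ae (.of_forall fun y => ?_)
      simp only [hGeq]
      rw [smul_mul_assoc, mul_comm (φ y)]
    · simp [h0 x hx]
  have hR : ∀ y : ℝ, ∫ x, G (y - x) • (f x * φ y) = (∫ x, greenKernel (x - y) • f x) * φ y := by
    intro y
    rw [← integral_mul_const]
    refine integral_congr_ae (.of_forall fun x => ?_)
    simp only [hGeq]
    rw [smul_mul_assoc]
  calc _ = ∫ x, cutoffPotential φ x * f x := ofIntegrable_apply hf _
    _ = ∫ x, ∫ y, G (y - x) • (f x * φ y) := by simp only [hL]
    _ = ∫ y, ∫ x, G (y - x) • (f x * φ y) := (integral_integral_swap hprod).symm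
    _ = ∫ y, (∫ x, greenKernel (x - y) • f x) * φ y := by simp only [hR]
    _ = _ := by
        rw [setIntegral_eq_integral_of_forall_compl_eq_zero]
        intro y hy
        rw [testFunction_eq_zero φ hy, mul_zero]

end FlatScreen

/-! ### The substitution `x = cos θ` and an oscillatory integral -/

namespace FlatScreen

open FourierTransform

theorem cos_image_Ioo : Real.cos '' Set.Ioo 0 Real.pi = Set.Ioo (-1) 1 := by
  ext x
  constructor
  · rintro ⟨θ, hθ, rfl⟩
    refine ⟨?_, ?_⟩
    · have := Real.strictAntiOn_cos (Set.Ioo_subset_Icc_self hθ)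
        (Set.right_mem_Icc.2 Real.pi_pos.le) hθ.2
      simpa using this
    · have := Real.strictAntiOn_cos (Set.left_mem_Icc.2 Real.pi_pos.le)
        (Set.Ioo_subset_Icc_self hθ) hθ.1
      simpa using this
  · intro hx
    exact ⟨Real.arccos x, ⟨Real.arccos_pos.2 hx.2, Real.arccos_lt_pi.2 hx.1⟩,
      Real.cos_arccos hx.1.le hx.2.le⟩

theorem abs_neg_sin_smul_div_sqrt (F : ℝ → ℂ) {θ : ℝ} (hθ : θ ∈ Set.Ioo 0 Real.pi) :
    |-Real.sin θ| • (F (Real.cos θ) / (Real.sqrt (1 - Real.cos θ ^ 2) : ℂ)) = F (Real.cos θ) := by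
  have h := Real.sin_pos_of_pos_of_lt_pi hθ.1 hθ.2
  have : Real.sqrt (1 - Real.cos θ ^ 2) = Real.sin θ := by
    rw [← Real.sin_sq, Real.sqrt_sq h.le]
  have h' : (Real.sin θ : ℂ) ≠ 0 := by exact_mod_cast h.ne'
  rw [this, abs_neg, abs_of_pos h, Complex.real_smul]
  field_simp

theorem injOn_cos_Ioo : Set.InjOn Real.cos (Set.Ioo 0 Real.pi) :=
  Real.injOn_cos.mono Set.Ioo_subset_Icc_self

theorem setIntegral_div_sqrt (F : ℝ → ℂ) :
    ∫ x in Set.Ioo (-1 : ℝ) 1, F x / (Real.sqrt (1 - x ^ 2) : ℂ) =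
      ∫ θ in Set.Ioo 0 Real.pi, F (Real.cos θ) := by
  rw [← cos_image_Ioo, integral_image_eq_integral_abs_deriv_smul measurableSet_Ioo
    (fun x _ => (Real.hasDerivAt_cos x).hasDerivWithinAt) injOn_cos_Ioo]
  exact setIntegral_congr_fun measurableSet_Ioo fun θ hθ => abs_neg_sin_smul_div_sqrt F hθ

theorem integrableOn_div_sqrt_iff (F : ℝ → ℂ) :
    IntegrableOn (fun x => F x / (Real.sqrt (1 - x ^ 2) : ℂ)) (Set.Ioo (-1 : ℝ) 1) ↔
      IntegrableOn (fun θ => F (Real.cos θ)) (Set.Ioo 0 Real.pi) := by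
  rw [← cos_image_Ioo, integrableOn_image_iff_integrableOn_abs_deriv_smul measurableSet_Ioo
    (fun x _ => (Real.hasDerivAt_cos x).hasDerivWithinAt) injOn_cos_Ioo]
  exact integrableOn_congr_fun (fun θ hθ => abs_neg_sin_smul_div_sqrt F hθ) measurableSet_Ioo

/-- The function `α / √(1 - x²)` on `(-1, 1)`, extended by zero. -/
noncomputable def weighted (α : ℝ → ℂ) : ℝ → ℂ :=
  (Set.Ioo (-1 : ℝ) 1).indicator fun x => α x / (Real.sqrt (1 - x ^ 2) : ℂ)

theorem continuous_comp_cos {α : ℝ → ℂ} (hα : ContinuousOn α (Set.Icc (-1) 1)) :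
    Continuous fun θ => α (Real.cos θ) :=
  hα.comp_continuous Real.continuous_cos Real.cos_mem_Icc

theorem integrableOn_div_sqrt {α : ℝ → ℂ} (hα : ContinuousOn α (Set.Icc (-1) 1)) :
    IntegrableOn (fun x => α x / (Real.sqrt (1 - x ^ 2) : ℂ)) (Set.Ioo (-1 : ℝ) 1) :=
  (integrableOn_div_sqrt_iff α).2 <|
    ((continuous_comp_cos hα).continuousOn.integrableOn_Icc).mono_set Set.Ioo_subset_Icc_self

theorem integrable_weighted {α : ℝ → ℂ} (hα : ContinuousOn α (Set.Icc (-1) 1)) :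
    Integrable (weighted α) :=
  (integrableOn_div_sqrt hα).integrable_indicator measurableSet_Ioo

theorem integral_mul_weighted (α F : ℝ → ℂ) :
    ∫ x, F x * weighted α x = ∫ θ in (0 : ℝ)..Real.pi, α (Real.cos θ) * F (Real.cos θ) := by
  rw [intervalIntegral.integral_of_le Real.pi_pos.le, integral_Ioc_eq_integral_Ioo,
    ← setIntegral_div_sqrt fun x => α x * F x, ← integral_indicator measurableSet_Ioo]
  refine integral_congr_ae (.of_forall fun x => ?_)
  simp only [weighted, Set.indicator_apply]
  split_ifs <;> ring

theorem half_mul_le_sin {δ θ : ℝ} (hδ : 0 < δ) (h1 : δ ≤ θ) (h2 : θ ≤ Real.pi - δ) :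
    δ / 2 ≤ Real.sin θ := by
  have key : ∀ x, δ ≤ x → x ≤ Real.pi / 2 → δ / 2 ≤ Real.sin x := fun x hx hx' => by
    refine le_trans ?_ (Real.mul_le_sin (hδ.le.trans hx) hx')
    have : 1 / 2 ≤ 2 / Real.pi := by
      rw [div_le_div_iff₀ two_pos Real.pi_pos]
      linarith [Real.pi_le_four]
    calc δ / 2 = 1 / 2 * δ := by ring
      _ ≤ 2 / Real.pi * x := by gcongr
  by_cases h : θ ≤ Real.pi / 2
  · exact key θ h1 h
  · rw [← Real.sin_pi_sub]
    exact key _ (by linarith) (by linarith)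

theorem hasDerivAt_cexp_cos (lam : ℝ) (θ : ℝ) :
    HasDerivAt (fun θ : ℝ => Complex.exp (lam * Real.cos θ * Complex.I))
      (-(lam * Real.sin θ * Complex.I) * Complex.exp (lam * Real.cos θ * Complex.I)) θ := by
  have := (((Real.hasDerivAt_cos θ).ofReal_comp.const_mul (lam : ℂ)).mul_const Complex.I).cexp
  convert! this using 1
  push_cast
  ring

theorem norm_cexp_ofReal_mul_I (x y : ℝ) : ‖Complex.exp (x * y * Complex.I)‖ = 1 := by
  rw [← Complex.ofReal_mul, Complex.norm_exp_ofReal_mul_I]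

/-- Away from the stationary points `0` and `π` the phase derivative is at least `|lam| δ / 2` in
size, so dividing by it and integrating by parts gains the factor `1/|lam|`. The boundary terms give
`4A`, the remaining integral `4π(A + B)`. -/
theorem norm_integral_middle_le {a a' : ℝ → ℂ} (ha : ∀ θ, HasDerivAt a (a' θ) θ)
    (ha' : Continuous a') {A B : ℝ} (hA : ∀ θ, ‖a θ‖ ≤ A) (hB : ∀ θ, ‖a' θ‖ ≤ B)
    {lam δ : ℝ} (hlam : lam ≠ 0) (hδ : 0 < δ) (hδ1 : δ ≤ 1) :
    ‖∫ θ in δ..(Real.pi - δ), a θ * Complex.exp (lam * Real.cos θ * Complex.I)‖ ≤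
      (4 * A + 4 * Real.pi * (A + B)) / (|lam| * δ ^ 2) := by
  have hA0 : 0 ≤ A := (norm_nonneg _).trans (hA 0)
  have hB0 : 0 ≤ B := (norm_nonneg _).trans (hB 0)
  have hle : δ ≤ Real.pi - δ := by linarith [Real.pi_gt_three]
  have hsin : ∀ θ ∈ Set.uIcc δ (Real.pi - δ), δ / 2 ≤ Real.sin θ := fun θ hθ => by
    rw [Set.uIcc_of_le hle] at hθ
    exact half_mul_le_sin hδ hθ.1 hθ.2
  have hlam' : 0 < |lam| := abs_pos.2 hlam
  have hlamC : (lam : ℂ) ≠ 0 := by exact_mod_cast hlam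
  let u : ℝ → ℂ := fun θ => a θ / (-(lam * Real.sin θ * Complex.I))
  let u' : ℝ → ℂ := fun θ => (a' θ * (-(lam * Real.sin θ * Complex.I)) -
    a θ * (-(lam * Real.cos θ * Complex.I))) / (-(lam * Real.sin θ * Complex.I)) ^ 2
  let v : ℝ → ℂ := fun θ => Complex.exp (lam * Real.cos θ * Complex.I)
  have hne : ∀ θ ∈ Set.uIcc δ (Real.pi - δ), -(lam * (Real.sin θ : ℂ) * Complex.I) ≠ 0 := by
    intro θ hθ
    have : (Real.sin θ : ℂ) ≠ 0 := by
      have := hsin θ hθ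
      exact_mod_cast (by linarith : 0 < Real.sin θ).ne'
    simp [hlamC, this, -Complex.ofReal_sin]
  have hnorm : ∀ θ, ‖-(lam * (Real.sin θ : ℂ) * Complex.I)‖ = |lam| * |Real.sin θ| := by
    intro θ
    simp [-Complex.ofReal_sin]
  have hu : ∀ θ ∈ Set.uIcc δ (Real.pi - δ), HasDerivAt u (u' θ) θ := fun θ hθ =>
    (ha θ).div ((((Real.hasDerivAt_sin θ).ofReal_comp.const_mul (lam : ℂ)).mul_const
      Complex.I).neg) (hne θ hθ)
  have hacont : Continuous a := continuous_iff_continuousAt.2 fun θ => (ha θ).continuousAt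
  have hu' : IntervalIntegrable u' volume δ (Real.pi - δ) := by
    refine ContinuousOn.intervalIntegrable (ContinuousOn.div (by fun_prop) (by fun_prop) ?_)
    exact fun θ hθ => pow_ne_zero 2 (hne θ hθ)
  have hv := hasDerivAt_cexp_cos lam
  have hparts := intervalIntegral.integral_mul_deriv_eq_deriv_mul hu (fun θ _ => hv θ) hu'
    ((by fun_prop : Continuous _).intervalIntegrable _ _)
  have hubd : ∀ θ ∈ Set.uIcc δ (Real.pi - δ), ‖u θ‖ ≤ 2 * A / (|lam| * δ ^ 2) := by
    intro θ hθ
    have h := hsin θ hθ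
    simp only [u]
    rw [norm_div, hnorm, abs_of_pos (by linarith : 0 < Real.sin θ)]
    calc _ ≤ A / (|lam| * (δ / 2)) := by
          gcongr
          exact hA θ
      _ = 2 * A / (|lam| * δ) := by field_simp
      _ ≤ 2 * A / (|lam| * δ ^ 2) := by
          gcongr
          nlinarith
  have hu'bd : ∀ θ ∈ Set.uIcc δ (Real.pi - δ), ‖u' θ‖ ≤ 4 * (A + B) / (|lam| * δ ^ 2) := by
    intro θ hθ
    have h := hsin θ hθ
    simp only [u']
    rw [norm_div, norm_pow, hnorm, abs_of_pos (by linarith : 0 < Real.sin θ)]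
    have hnum : ‖a' θ * (-(lam * Real.sin θ * Complex.I)) -
        a θ * (-(lam * Real.cos θ * Complex.I))‖ ≤ |lam| * (A + B) := by
      refine (norm_sub_le _ _).trans ?_
      rw [norm_mul, norm_mul, hnorm, norm_neg, norm_mul, norm_mul, Complex.norm_I,
        Complex.norm_real, Complex.norm_real, mul_one]
      have := hA θ
      have := hB θ
      calc _ ≤ B * (|lam| * 1) + A * (‖lam‖ * 1) := by
            gcongr
            · exact Real.abs_sin_le_one θ
            · exact Real.abs_cos_le_one θ
        _ = _ := by rw [Real.norm_eq_abs]; ring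
    calc _ ≤ |lam| * (A + B) / (|lam| * (δ / 2)) ^ 2 := by gcongr
      _ = _ := by field_simp; norm_num
  have e : ∀ θ ∈ Set.uIcc δ (Real.pi - δ), a θ * v θ =
      u θ * (-(lam * Real.sin θ * Complex.I) * Complex.exp (lam * Real.cos θ * Complex.I)) := by
    intro θ hθ
    have := hne θ hθ
    simp only [u, v]
    rw [← mul_assoc, div_mul_cancel₀ _ this]
  rw [intervalIntegral.integral_congr e, hparts]
  have hI : ‖∫ θ in δ..(Real.pi - δ), u' θ * Complex.exp (lam * Real.cos θ * Complex.I)‖ ≤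
      4 * (A + B) / (|lam| * δ ^ 2) * |Real.pi - δ - δ| := by
    refine intervalIntegral.norm_integral_le_of_norm_le_const fun θ hθ => ?_
    rw [norm_mul, norm_cexp_ofReal_mul_I, mul_one]
    exact hu'bd θ (Set.uIoc_subset_uIcc hθ)
  have habs : |Real.pi - δ - δ| ≤ Real.pi := by
    rw [abs_of_nonneg (by linarith)]
    linarith
  have h1 := hubd δ Set.left_mem_uIcc
  have h2 := hubd _ (Set.right_mem_uIcc (a := δ))
  calc _ ≤ ‖u (Real.pi - δ)‖ + ‖u δ‖ + 4 * (A + B) / (|lam| * δ ^ 2) * Real.pi := by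
        refine (norm_sub_le _ _).trans (add_le_add ((norm_sub_le _ _).trans ?_)
          (hI.trans (by gcongr)))
        rw [norm_mul, norm_mul, norm_cexp_ofReal_mul_I, norm_cexp_ofReal_mul_I, mul_one, mul_one]
    _ ≤ 2 * A / (|lam| * δ ^ 2) + 2 * A / (|lam| * δ ^ 2) +
        4 * (A + B) / (|lam| * δ ^ 2) * Real.pi := by gcongr
    _ = _ := by field_simp; ring

/-- The two end intervals of length `δ` are estimated trivially. -/
theorem norm_integral_exp_cos_le {a a' : ℝ → ℂ} (ha : ∀ θ, HasDerivAt a (a' θ) θ)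
    (ha' : Continuous a') {A B : ℝ} (hA : ∀ θ, ‖a θ‖ ≤ A) (hB : ∀ θ, ‖a' θ‖ ≤ B)
    {lam δ : ℝ} (hlam : lam ≠ 0) (hδ : 0 < δ) (hδ1 : δ ≤ 1) :
    ‖∫ θ in (0 : ℝ)..Real.pi, a θ * Complex.exp (lam * Real.cos θ * Complex.I)‖ ≤
      2 * A * δ + (4 * A + 4 * Real.pi * (A + B)) / (|lam| * δ ^ 2) := by
  have hacont : Continuous a := continuous_iff_continuousAt.2 fun θ => (ha θ).continuousAt
  have hi (x y : ℝ) : IntervalIntegrable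
      (fun θ => a θ * Complex.exp (lam * Real.cos θ * Complex.I)) volume x y :=
    (by fun_prop : Continuous _).intervalIntegrable _ _
  have hs (x y : ℝ) : ‖∫ θ in x..y, a θ * Complex.exp (lam * Real.cos θ * Complex.I)‖ ≤
      A * |y - x| := by
    refine intervalIntegral.norm_integral_le_of_norm_le_const fun θ hθ => ?_
    rw [norm_mul, norm_cexp_ofReal_mul_I, mul_one]
    exact hA θ
  rw [← intervalIntegral.integral_add_adjacent_intervals (hi 0 (Real.pi - δ)) (hi _ _),
    ← intervalIntegral.integral_add_adjacent_intervals (hi 0 δ) (hi _ _)]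
  have h1 := hs 0 δ
  have h2 := hs (Real.pi - δ) Real.pi
  rw [sub_zero, abs_of_pos hδ] at h1
  rw [sub_sub_cancel, abs_of_pos hδ] at h2
  have h3 := norm_integral_middle_le ha ha' hA hB hlam hδ hδ1
  refine (norm_add₃_le).trans ?_
  linarith

end FlatScreen

/-! ### Sobolev regularity of the density and existence of a solution -/

namespace FlatScreen

open FourierTransform

/-- The choice `δ = |ξ|^(-1/3)` balances `δ` against `1/(|ξ| δ²)`. The resulting decay `|ξ|^(-1/3)`
is not optimal but suffices for `H^{-1/2}`. -/
theorem exists_norm_fourier_weighted_le {α : ℝ → ℂ} (hα : ContDiffOn ℝ ∞ α (Set.Icc (-1) 1)) :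
    ∃ C : ℝ, ∀ ξ, ‖𝓕 (weighted α) ξ‖ ≤ C * (1 + ‖ξ‖ ^ 2) ^ (-(1 / 6) : ℝ) := by
  set a : ℝ → ℂ := fun θ => α (Real.cos θ) with ha
  have hsm : ContDiff ℝ ∞ a := by
    rw [← contDiffOn_univ]
    exact hα.comp (Real.contDiff_cos.contDiffOn) fun θ _ => Real.cos_mem_Icc θ
  have hd : ∀ θ, HasDerivAt a (deriv a θ) θ := fun θ =>
    ((contDiff_infty_iff_deriv.1 hsm).1 θ).hasDerivAt
  have hdc : Continuous (deriv a) := (contDiff_infty_iff_deriv.1 hsm).2.continuous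
  have hper : Function.Periodic a (2 * Real.pi) := fun θ => by
    simp only [ha, Real.cos_add_two_pi]
  have hdper : Function.Periodic (deriv a) (2 * Real.pi) := fun x => by
    rw [← deriv_comp_add_const]
    congr 1
    exact funext hper
  obtain ⟨A, hA⟩ := (hper.isBounded_of_continuous (by positivity)
    hsm.continuous).exists_norm_le
  obtain ⟨B, hB⟩ := (hdper.isBounded_of_continuous (by positivity) hdc).exists_norm_le
  replace hA : ∀ θ, ‖a θ‖ ≤ A := fun θ => hA _ ⟨θ, rfl⟩
  replace hB : ∀ θ, ‖deriv a θ‖ ≤ B := fun θ => hB _ ⟨θ, rfl⟩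
  have hA0 : 0 ≤ A := (norm_nonneg _).trans (hA 0)
  have hB0 : 0 ≤ B := (norm_nonneg _).trans (hB 0)
  have hF : ∀ ξ : ℝ, 𝓕 (weighted α) ξ = ∫ θ in (0 : ℝ)..Real.pi,
      a θ * Complex.exp (((-2 * Real.pi * ξ : ℝ) : ℂ) * Real.cos θ * Complex.I) := by
    intro ξ
    rw [Real.fourier_real_eq_integral_exp_smul, ← integral_mul_weighted α
      fun x => Complex.exp (((-2 * Real.pi * ξ : ℝ) : ℂ) * x * Complex.I)]
    congr 1 with x
    rw [smul_eq_mul]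
    push_cast
    ring_nf
  set K := 4 * A + 4 * Real.pi * (A + B) with hK
  have hK0 : 0 ≤ K := by positivity
  refine ⟨2 * (A * Real.pi + 2 * A + K), fun ξ => ?_⟩
  have hp : (0 : ℝ) < 1 + ‖ξ‖ ^ 2 := by positivity
  suffices h : ‖𝓕 (weighted α) ξ‖ * (1 + ‖ξ‖ ^ 2) ^ (1 / 6 : ℝ) ≤
      2 * (A * Real.pi + 2 * A + K) by
    rwa [Real.rpow_neg hp.le, ← div_eq_mul_inv, le_div_iff₀ (by positivity)]
  rw [hF]
  -- For small `ξ` the trivial bound `Aπ` is enough; the oscillation is used only for `|ξ| ≥ 1`,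
  -- where `δ ≤ 1`.
  rcases le_total ‖ξ‖ 1 with h1 | h1
  · have hI : ‖∫ θ in (0 : ℝ)..Real.pi,
        a θ * Complex.exp (((-2 * Real.pi * ξ : ℝ) : ℂ) * Real.cos θ * Complex.I)‖ ≤
        A * |Real.pi - 0| := by
      refine intervalIntegral.norm_integral_le_of_norm_le_const fun θ hθ => ?_
      rw [norm_mul, norm_cexp_ofReal_mul_I, mul_one]
      exact hA θ
    rw [sub_zero, abs_of_pos Real.pi_pos] at hI
    have h2 : (1 + ‖ξ‖ ^ 2) ^ (1 / 6 : ℝ) ≤ 2 := by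
      calc _ ≤ (2 : ℝ) ^ (1 / 6 : ℝ) := by
            gcongr
            nlinarith [norm_nonneg ξ]
        _ ≤ 2 ^ (1 : ℝ) := by
            gcongr <;> norm_num
        _ = 2 := by norm_num
    calc _ ≤ A * Real.pi * 2 := by gcongr
      _ ≤ _ := by linarith
  · have h0 : 0 < ‖ξ‖ := by linarith
    set t := ‖ξ‖ ^ (1 / 3 : ℝ) with ht
    have ht1 : 1 ≤ t := Real.one_le_rpow h1 (by norm_num)
    have ht3 : t ^ 3 = ‖ξ‖ := by
      rw [ht, ← Real.rpow_mul_natCast h0.le]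
      norm_num
    have hlam : -2 * Real.pi * ξ ≠ 0 := by
      have : ξ ≠ 0 := norm_pos_iff.1 h0
      have := Real.pi_pos.ne'
      simp [*]
    have hI := norm_integral_exp_cos_le hd hdc hA hB hlam (δ := t⁻¹) (by positivity)
      (inv_le_one_of_one_le₀ ht1)
    have hl : ‖ξ‖ ≤ |-2 * Real.pi * ξ| := by
      rw [abs_mul, abs_mul, abs_neg, abs_two, abs_of_pos Real.pi_pos, ← Real.norm_eq_abs]
      nlinarith [Real.pi_gt_three]
    have h2 : (1 + ‖ξ‖ ^ 2) ^ (1 / 6 : ℝ) ≤ 2 * t := by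
      calc _ ≤ (2 * ‖ξ‖ ^ 2) ^ (1 / 6 : ℝ) := by
            gcongr
            nlinarith
        _ = 2 ^ (1 / 6 : ℝ) * t := by
            rw [Real.mul_rpow (by norm_num) (by positivity), ht, ← Real.rpow_natCast_mul h0.le]
            norm_num
        _ ≤ 2 ^ (1 : ℝ) * t := by
            gcongr <;> norm_num
        _ = _ := by norm_num
    have hI2 : 2 * A * t⁻¹ + K / (|-2 * Real.pi * ξ| * t⁻¹ ^ 2) ≤ (2 * A + K) * t⁻¹ := by
      have : K / (|-2 * Real.pi * ξ| * t⁻¹ ^ 2) ≤ K / (‖ξ‖ * t⁻¹ ^ 2) := by gcongr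
      have e : K / (‖ξ‖ * t⁻¹ ^ 2) = K * t⁻¹ := by
        rw [← ht3]
        field_simp
      linarith
    calc _ ≤ ((2 * A + K) * t⁻¹) * (2 * t) := by
          gcongr
          exact hI.trans hI2
      _ = 2 * (2 * A + K) := by field_simp
      _ ≤ _ := by nlinarith [Real.pi_pos]

/-- The distribution `α / √(1 - x²)`. -/
noncomputable def weightedDistribution {α : ℝ → ℂ} (hα : ContinuousOn α (Set.Icc (-1) 1)) :
    𝓢'(ℝ, ℂ) :=
  ofIntegrable (integrable_weighted hα)

theorem weighted_eq_zero (α : ℝ → ℂ) {x : ℝ} (hx : x ∉ Set.Ioo (-1 : ℝ) 1) : weighted α x = 0 :=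
  Set.indicator_of_notMem hx _

theorem weightedDistribution_mem {α : ℝ → ℂ} (hα : ContDiffOn ℝ ∞ α (Set.Icc (-1) 1)) :
    weightedDistribution hα.continuousOn ∈ HTilde (-1 / 2) := by
  obtain ⟨C, hC⟩ := exists_norm_fourier_weighted_le hα
  exact ⟨memSobolev_ofIntegrable _ hC, dsupport_ofIntegrable_subset _ isClosed_Icc fun x hx =>
    weighted_eq_zero α fun h => hx (Set.Ioo_subset_Icc_self h)⟩

theorem isRepresentedBy_weightedDistribution {α : ℝ → ℂ}
    (hα : ContinuousOn α (Set.Icc (-1) 1)) :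
    IsRepresentedBy (weightedDistribution hα) fun x => α x / (Real.sqrt (1 - x ^ 2) : ℂ) := by
  refine ⟨integrableOn_div_sqrt hα, fun φ => ?_⟩
  rw [weightedDistribution, ofIntegrable_apply, ← integral_indicator measurableSet_Ioo]
  congr 1 with x
  simp only [weighted, Set.indicator_apply]
  split_ifs <;> ring

theorem intervalIntegrable_greenKernel_cos_sub (y : ℝ) :
    IntervalIntegrable (fun θ => greenKernel (Real.cos θ - y)) volume 0 Real.pi :=
  (intervalIntegrable_log_cos_sub y 0 Real.pi).const_mul _

/-- The series may be integrated termwise: `‖c n‖ |G₀(cos θ - y)|` dominates, with summable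
coefficients and an integrable kernel. -/
theorem integral_chebyshevSeries_mul_greenKernel {c : ℤ → ℂ}
    (hc : ∀ k : ℕ, Summable fun n : ℤ => |(n : ℝ)| ^ k * ‖c n‖) {y : ℝ}
    (hy : y ∈ Set.Icc (-1 : ℝ) 1) :
    HasSum (fun n => c n * layerEigenvalue n * (((Polynomial.Chebyshev.T ℝ n).eval y : ℝ) : ℂ))
      (∫ θ in (0 : ℝ)..Real.pi, chebyshevSeries c 0 (Real.cos θ) *
        (greenKernel (Real.cos θ - y) : ℂ)) := by
  have hK := intervalIntegrable_greenKernel_cos_sub y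
  have h0 := hc 0
  simp only [pow_zero, one_mul] at h0
  have h := intervalIntegral.hasSum_integral_of_dominated_convergence (ι := ℤ) (μ := volume)
    (a := 0) (b := Real.pi)
    (F := fun n θ => c n * (Real.cos (n * θ) * greenKernel (Real.cos θ - y) : ℝ))
    (f := fun θ => chebyshevSeries c 0 (Real.cos θ) * (greenKernel (Real.cos θ - y) : ℂ))
    (fun n θ => ‖c n‖ * |greenKernel (Real.cos θ - y)|) ?_ ?_ ?_ ?_ ?_
  · convert! h using 2 with n
    rw [intervalIntegral.integral_const_mul, intervalIntegral.integral_ofReal,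
      integral_cos_mul_greenKernel n hy]
    push_cast
    ring
  · intro n
    refine AEStronglyMeasurable.const_mul ?_ _
    refine Complex.continuous_ofReal.comp_aestronglyMeasurable ?_
    refine (by fun_prop : Continuous fun θ : ℝ => Real.cos (n * θ)).aestronglyMeasurable.mul ?_
    rw [Set.uIoc_of_le Real.pi_pos.le]
    exact hK.aestronglyMeasurable
  · refine fun n => .of_forall fun θ _ => ?_
    rw [norm_mul, Complex.norm_real, Real.norm_eq_abs, abs_mul]
    gcongr
    exact mul_le_of_le_one_left (abs_nonneg _) (Real.abs_cos_le_one _)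
  · exact .of_forall fun θ _ => h0.mul_right _
  · simp only [tsum_mul_right]
    exact hK.abs.const_mul _
  · refine .of_forall fun θ _ => ?_
    have := (summable_chebyshevSeries hc 0 (Real.cos_mem_Icc θ)).hasSum.mul_right
      ((greenKernel (Real.cos θ - y) : ℝ) : ℂ)
    convert! this using 2 with n
    simp [Polynomial.Chebyshev.T_real_cos]
    ring

theorem singleLayer_weightedDistribution {α : ℝ → ℂ} (hα : ContinuousOn α (Set.Icc (-1) 1))
    (φ : 𝓓(segmentInterior, ℂ)) :
    singleLayer (weightedDistribution hα) φ = ∫ y in Set.Ioo (-1 : ℝ) 1,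
      (∫ θ in (0 : ℝ)..Real.pi, α (Real.cos θ) * (greenKernel (Real.cos θ - y) : ℂ)) * φ y := by
  rw [weightedDistribution,
    singleLayer_ofIntegrable _ fun x hx => weighted_eq_zero α hx]
  simp only [Complex.real_smul]
  congr 1 with y
  rw [integral_mul_weighted α fun x => (greenKernel (x - y) : ℂ)]

/-- For `n ≠ 0` division by the eigenvalue is multiplication by `2|n|`, which costs one power; the
single index `n = 0` is irrelevant for summability. -/
theorem summable_div_layerEigenvalue {c : ℤ → ℂ}
    (hc : ∀ k : ℕ, Summable fun n : ℤ => |(n : ℝ)| ^ k * ‖c n‖) (k : ℕ) :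
    Summable fun n : ℤ => |(n : ℝ)| ^ k * ‖c n / layerEigenvalue n‖ := by
  refine Summable.of_norm_bounded_eventually ((hc (k + 1)).mul_left 2) ?_
  filter_upwards [Filter.eventually_cofinite_ne 0] with n hn
  rw [Real.norm_of_nonneg (by positivity), norm_div, Complex.norm_real,
    Real.norm_of_nonneg (layerEigenvalue_pos n).le, layerEigenvalue, if_neg hn]
  refine le_of_eq ?_
  field_simp
  ring

/-- Existence: for smooth data the single-layer equation has a solution `α / √(1 - x²)` with
smooth `α`. -/
theorem exists_weighted_solution {g : ℝ → ℂ} (hg : ContDiffOn ℝ ∞ g (Set.Icc (-1) 1)) :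
    ∃ (α : ℝ → ℂ) (hα : ContDiffOn ℝ ∞ α (Set.Icc (-1) 1)),
      IsSolution (weightedDistribution hα.continuousOn) g := by
  obtain ⟨c, hc, hsum⟩ := exists_chebyshev_expansion hg
  have hc' := summable_div_layerEigenvalue hc
  have hα := contDiffOn_chebyshevSeries hc' 0
  refine ⟨_, hα, weightedDistribution_mem hα, fun φ => ?_⟩
  rw [singleLayer_weightedDistribution]
  refine setIntegral_congr_fun measurableSet_Ioo fun y hy => ?_
  have h := integral_chebyshevSeries_mul_greenKernel hc' (Set.Ioo_subset_Icc_self hy)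
  congr 1
  refine h.unique ?_
  convert! hsum y (Set.Ioo_subset_Icc_self hy) using 2 with n
  have : (layerEigenvalue n : ℂ) ≠ 0 := by exact_mod_cast (layerEigenvalue_pos n).ne'
  rw [div_mul_cancel₀ _ this]

end FlatScreen

/-! ### Structure of `H^{-1}` and supports of distributions -/

namespace FlatScreen

open FourierTransform
open scoped LineDeriv Laplacian

/-- In this normalisation of the Fourier transform `Δ` has symbol `-(2π)²|ξ|²`, while the Bessel
potential has symbol `1 + |ξ|²`. -/
theorem besselPotential_two_eq (t : 𝓢'(ℝ, ℂ)) :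
    besselPotential ℝ ℂ 2 t = t - ((2 * Real.pi) ^ 2)⁻¹ • Δ t := by
  have h1 : (fun x : ℝ => (((1 + ‖x‖ ^ 2) ^ ((2 : ℝ) / 2) : ℝ) : ℂ)) =
      (fun _ => (1 : ℂ)) + fun x : ℝ => ((‖x‖ ^ 2 : ℝ) : ℂ) := by
    funext x
    simp
  have h2 : (2 * Real.pi) ^ 2 ≠ 0 := by positivity
  rw [TemperedDistribution.laplacian_eq_fourierMultiplierCLM, besselPotential,
    TemperedDistribution.fourierMultiplierCLM_apply, h1,
    TemperedDistribution.smulLeftCLM_add (by fun_prop) (by fun_prop),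
    TemperedDistribution.fourierMultiplierCLM_apply]
  simp only [add_apply, TemperedDistribution.smulLeftCLM_const, one_smul,
    FourierTransform.fourierInv_add, FourierTransform.fourierInv_fourier_eq]
  rw [neg_smul, smul_neg, sub_neg_eq_add, inv_smul_smul₀ h2]

theorem lineDerivOp_one_apply (ψ : 𝓢(ℝ, ℂ)) (x : ℝ) : (∂_{(1 : ℝ)} ψ) x = deriv ψ x := by
  rw [SchwartzMap.lineDerivOp_apply_eq_fderiv, fderiv_eq_smul_deriv, one_smul]

/-- An element of `H^{-1}(ℝ)` is the sum of a square integrable function and the derivative of a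
square integrable function. -/
theorem exists_L2_decomposition {u : 𝓢'(ℝ, ℂ)} (hu : MemSobolev (-1) 2 u) :
    ∃ a b : Lp ℂ 2 (volume : Measure ℝ),
      ∀ ψ : 𝓢(ℝ, ℂ), u ψ = (∫ x, ψ x * a x) + ∫ x, deriv ψ x * b x := by
  -- Here `t` is in `H¹` and `u = t - t''/(2π)²`, so `t` and a multiple of `t'` are the required
  -- functions.
  set t := besselPotential ℝ ℂ (-2) u with ht
  have ht1 : MemSobolev 1 2 t := by
    rw [ht, memSobolev_besselPotential_iff]
    norm_num
    exact hu
  obtain ⟨a, ha⟩ := memSobolev_zero_iff.1 (ht1.mono (zero_le_one))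
  have hdt := ht1.lineDerivOp (m := (1 : ℝ))
  rw [sub_self] at hdt
  obtain ⟨b, hb⟩ := memSobolev_zero_iff.1 hdt
  have hut : u = besselPotential ℝ ℂ 2 t := by
    rw [ht, besselPotential_besselPotential_apply]
    simp
  refine ⟨a, (((2 * Real.pi) ^ 2)⁻¹ : ℂ) • b, fun ψ => ?_⟩
  have hΔ : (Δ t) ψ = -∫ x, deriv ψ x * b x := by
    rw [TemperedDistribution.laplacian_eq_sum (OrthonormalBasis.singleton (Fin 1) ℝ)]
    simp only [Finset.univ_unique, Finset.sum_singleton, OrthonormalBasis.singleton_apply]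
    rw [hb, TemperedDistribution.lineDerivOp_apply_apply, map_neg,
      Lp.toTemperedDistribution_apply]
    simp only [lineDerivOp_one_apply, smul_eq_mul]
  have hb' : ∫ x, deriv ψ x * ((((2 * Real.pi) ^ 2)⁻¹ : ℂ) • b : Lp ℂ 2 (volume : Measure ℝ)) x =
      (((2 * Real.pi) ^ 2)⁻¹ : ℂ) * ∫ x, deriv ψ x * b x := by
    rw [← integral_const_mul]
    refine integral_congr_ae ?_
    filter_upwards [Lp.coeFn_smul (((2 * Real.pi) ^ 2)⁻¹ : ℂ) b] with x hx
    rw [hx, Pi.smul_apply, smul_eq_mul]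
    ring
  rw [hb']
  conv_lhs => rw [hut, besselPotential_two_eq]
  change t ψ - (((2 * Real.pi) ^ 2)⁻¹ : ℝ) • (Δ t) ψ = _
  rw [hΔ]
  nth_rw 1 [ha]
  rw [Lp.toTemperedDistribution_apply, Complex.real_smul]
  simp only [smul_eq_mul]
  push_cast
  ring

open scoped Manifold in
theorem exists_contDiff_partition {ι : Type*} [Fintype ι] {s : Set ℝ} (hs : IsClosed s)
    (U : ι → Set ℝ) (hU : ∀ i, IsOpen (U i)) (hsU : s ⊆ ⋃ i, U i) :
    ∃ ρ : ι → ℝ → ℝ, (∀ i, ContDiff ℝ ∞ (ρ i)) ∧ (∀ i, tsupport (ρ i) ⊆ U i) ∧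
      ∀ x ∈ s, ∑ i, ρ i x = 1 := by
  obtain ⟨ρ, hρ⟩ := SmoothPartitionOfUnity.exists_isSubordinate 𝓘(ℝ) hs U hU hsU
  refine ⟨fun i => ρ i, fun i => (ρ i).contMDiff.contDiff, hρ, fun x hx => ?_⟩
  rw [← finsum_eq_sum_of_fintype]
  exact ρ.sum_eq_one hx

/-- A tempered distribution vanishes on compactly supported test functions whose support does not
meet the support of the distribution. -/
theorem apply_eq_zero_of_hasCompactSupport {u : 𝓢'(ℝ, ℂ)} {s : Set ℝ}
    (hu : Distribution.dsupport u ⊆ s) {ψ : 𝓢(ℝ, ℂ)} (hψ : HasCompactSupport ψ)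
    (hs : tsupport ψ ⊆ sᶜ) : u ψ = 0 := by
  have hcov : tsupport ψ ⊆ ⋃ U : {U : Set ℝ // Distribution.IsVanishingOn u U ∧ IsOpen U}, U.1 := by
    intro x hx
    have : x ∉ Distribution.dsupport u := fun h => hs hx (hu h)
    obtain ⟨U, h1, h2, h3⟩ := (Distribution.notMem_dsupport_iff x).1 this
    exact Set.mem_iUnion.2 ⟨⟨U, h1, h2⟩, h3⟩
  obtain ⟨t, ht⟩ := hψ.isCompact.elim_finite_subcover _ (fun U => U.2.2) hcov
  -- Finitely many open sets of vanishing cover the support; a smooth partition of unity splits `ψ`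
  -- into pieces on each of which `u` vanishes.
  obtain ⟨ρ, hρs, hρ, hρ1⟩ := exists_contDiff_partition (isClosed_tsupport ψ)
    (fun U : t => U.1.1) (fun U => U.1.2.2) (by simpa [Set.iUnion_subtype] using ht)
  have hsm (i : t) : ContDiff ℝ ∞ fun x => (ρ i x : ℝ) • ψ x :=
    (hρs i).smul (ψ.smooth ⊤)
  have hcs (i : t) : HasCompactSupport fun x => (ρ i x : ℝ) • ψ x :=
    hψ.mono fun x hx h => hx (by simp only [h, smul_zero])
  obtain ⟨Φ, hΦ⟩ : ∃ Φ : t → 𝓢(ℝ, ℂ), ∀ i, (Φ i : ℝ → ℂ) = fun x => (ρ i x : ℝ) • ψ x :=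
    ⟨fun i => (hcs i).toSchwartzMap (hsm i), fun i => rfl⟩
  have hsum : ψ = ∑ i : t, Φ i := by
    ext x
    rw [_root_.sum_apply]
    simp only [hΦ]
    by_cases hx : x ∈ tsupport ψ
    · rw [← Finset.sum_smul, hρ1 x hx, one_smul]
    · simp [image_eq_zero_of_notMem_tsupport hx]
  rw [hsum, map_sum]
  refine Finset.sum_eq_zero fun i _ => i.1.2.1 _ ?_
  rw [hΦ]
  exact (tsupport_smul_subset_left _ _).trans (hρ i)

end FlatScreen

/-! ### Non-compactly supported test functions; primitives -/

namespace FlatScreen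

open FourierTransform Filter Topology

theorem integrable_schwartz_mul (ψ : 𝓢(ℝ, ℂ)) (a : Lp ℂ 2 (volume : Measure ℝ)) :
    Integrable fun x => ψ x * a x :=
  (ψ.memLp 2).integrable_mul (Lp.memLp a)

theorem integrable_deriv_schwartz_mul (ψ : 𝓢(ℝ, ℂ)) (b : Lp ℂ 2 (volume : Measure ℝ)) :
    Integrable fun x => deriv ψ x * b x :=
  ((SchwartzMap.derivCLM ℂ ℂ ψ).memLp 2).integrable_mul (Lp.memLp b)

theorem contDiff_cutoff : ContDiff ℝ ∞ cutoff := cutoff.contDiff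

theorem exists_abs_deriv_cutoff_le : ∃ M : ℝ, ∀ x, |deriv cutoff x| ≤ M := by
  obtain ⟨M, hM⟩ := (cutoff.hasCompactSupport.deriv).exists_bound_of_continuous
    (contDiff_infty_iff_deriv.1 contDiff_cutoff).2.continuous
  exact ⟨M, hM⟩

theorem abs_cutoff_le_one (x : ℝ) : |cutoff x| ≤ 1 := by
  rw [abs_of_nonneg cutoff.nonneg]
  exact cutoff.le_one

/-- A distribution in `H^{-1}(ℝ)` vanishes on the Schwartz functions whose support does not meet
the support of the distribution. -/
theorem apply_eq_zero_of_tsupport_subset {u : 𝓢'(ℝ, ℂ)} (hu : MemSobolev (-1) 2 u) {s : Set ℝ}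
    (hs : Distribution.dsupport u ⊆ s) {ψ : 𝓢(ℝ, ℂ)} (hψ : tsupport ψ ⊆ sᶜ) : u ψ = 0 := by
  obtain ⟨a, b, hab⟩ := exists_L2_decomposition hu
  obtain ⟨M, hM⟩ := exists_abs_deriv_cutoff_le
  have hM0 : 0 ≤ M := (abs_nonneg _).trans (hM 0)
  -- The dilated cutoffs `cutoff (r n * x)` tend to `1` and their derivatives to `0`. Dominated
  -- convergence in the `L²` representation of `u` then reduces the claim to compact support.
  let r : ℕ → ℝ := fun n => ((n : ℝ) + 1)⁻¹
  have hr0 : ∀ n, r n ≠ 0 := fun n => by positivity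
  have hr1 : ∀ n, |r n| ≤ 1 := fun n => by
    rw [abs_of_nonneg (by positivity)]
    exact inv_le_one_of_one_le₀ (by linarith [n.cast_nonneg (α := ℝ)])
  have hr : Tendsto r atTop (𝓝 0) := by
    simpa only [one_div] using! tendsto_one_div_add_atTop_nhds_zero_nat (𝕜 := ℝ)
  have hsm (n : ℕ) : ContDiff ℝ ∞ fun x => cutoff (r n * x) • ψ x :=
    (contDiff_cutoff.comp (contDiff_const.mul contDiff_id)).smul (ψ.smooth ⊤)
  have hcs (n : ℕ) : HasCompactSupport fun x => cutoff (r n * x) • ψ x :=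
    (cutoff.hasCompactSupport.comp_smul (hr0 n)).mono fun x hx h =>
      hx (by simp only [smul_eq_mul] at h; simp only [h, zero_smul])
  have hd (n : ℕ) (x : ℝ) : deriv (fun x => cutoff (r n * x) • ψ x) x =
      cutoff (r n * x) • deriv ψ x + (deriv cutoff (r n * x) * r n) • ψ x := by
    have h1 : HasDerivAt (fun x => cutoff (r n * x)) (deriv cutoff (r n * x) * r n) x := by
      have := ((contDiff_infty_iff_deriv.1 contDiff_cutoff).1 (r n * x)).hasDerivAt
      simpa using! this.comp x ((hasDerivAt_id x).const_mul (r n))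
    exact (h1.smul (ψ.hasDerivAt x)).deriv
  have h0 (n : ℕ) : (∫ x, cutoff (r n * x) • ψ x * a x) + ∫ x, (cutoff (r n * x) • deriv ψ x +
      (deriv cutoff (r n * x) * r n) • ψ x) * b x = 0 := by
    have h1 : u ((hcs n).toSchwartzMap (hsm n)) = 0 := by
      refine apply_eq_zero_of_hasCompactSupport hs (hcs n) ?_
      exact (tsupport_smul_subset_right _ _).trans hψ
    rw [hab] at h1
    simp only [← hd]
    exact h1
  have hlim (x : ℝ) : Tendsto (fun n => r n * x) atTop (𝓝 0) := by
    simpa using hr.mul_const x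
  have hlim1 (x : ℝ) : Tendsto (fun n => cutoff (r n * x)) atTop (𝓝 1) := by
    have := (contDiff_cutoff.continuous.tendsto 0).comp (hlim x)
    rwa [cutoff_eq_one (by simp)] at this
  have hlim2 (x : ℝ) : Tendsto (fun n => deriv cutoff (r n * x) * r n) atTop (𝓝 0) := by
    refine squeeze_zero_norm (a := fun n => M * |r n|) (fun n => ?_) ?_
    · rw [norm_mul]
      exact mul_le_mul_of_nonneg_right (hM _) (abs_nonneg _)
    · simpa using hr.abs.const_mul M
  have hc (n : ℕ) : Continuous fun x => cutoff (r n * x) :=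
    contDiff_cutoff.continuous.comp (by fun_prop)
  have hdc (n : ℕ) : Continuous fun x => deriv cutoff (r n * x) :=
    (contDiff_infty_iff_deriv.1 contDiff_cutoff).2.continuous.comp (by fun_prop)
  have hψd : Continuous (deriv ψ) := (SchwartzMap.derivCLM ℂ ℂ ψ).continuous
  have t1 : Tendsto (fun n => ∫ x, cutoff (r n * x) • ψ x * a x) atTop (𝓝 (∫ x, ψ x * a x)) := by
    refine tendsto_integral_of_dominated_convergence _ (fun n => ?_)
      (integrable_schwartz_mul ψ a).norm (fun n => .of_forall fun x => ?_)
      (.of_forall fun x => ?_)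
    · exact ((hc n).smul ψ.continuous).aestronglyMeasurable.mul (Lp.aestronglyMeasurable a)
    · rw [smul_mul_assoc, norm_smul]
      exact mul_le_of_le_one_left (norm_nonneg _) (abs_cutoff_le_one _)
    · simpa using ((hlim1 x).smul_const (ψ x)).mul_const (a x)
  have t2 : Tendsto (fun n => ∫ x, (cutoff (r n * x) • deriv ψ x +
      (deriv cutoff (r n * x) * r n) • ψ x) * b x) atTop (𝓝 (∫ x, deriv ψ x * b x)) := by
    refine tendsto_integral_of_dominated_convergence
      (fun x => ‖deriv ψ x * b x‖ + M * ‖ψ x * b x‖) (fun n => ?_)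
      ((integrable_deriv_schwartz_mul ψ b).norm.add ((integrable_schwartz_mul ψ b).norm.const_mul M))
      (fun n => .of_forall fun x => ?_) (.of_forall fun x => ?_)
    · refine Continuous.aestronglyMeasurable ?_ |>.mul (Lp.aestronglyMeasurable b)
      exact ((hc n).smul hψd).add (((hdc n).mul continuous_const).smul ψ.continuous)
    · rw [add_mul, smul_mul_assoc, smul_mul_assoc]
      refine (norm_add_le _ _).trans (add_le_add ?_ ?_)
      · rw [norm_smul]
        exact mul_le_of_le_one_left (norm_nonneg _) (abs_cutoff_le_one _)
      · rw [norm_smul, norm_mul]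
        refine mul_le_mul_of_nonneg_right ?_ (norm_nonneg _)
        exact (mul_le_mul (hM _) (hr1 n) (abs_nonneg _) hM0).trans_eq (mul_one M)
    · simpa using (((hlim1 x).smul_const (deriv ψ x)).add
        ((hlim2 x).smul_const (ψ x))).mul_const (b x)
  rw [hab]
  refine tendsto_nhds_unique (t1.add t2) ?_
  simp only [h0]
  exact tendsto_const_nhds

/-- The product of a smooth function and the cutoff function, as a Schwartz function. -/
noncomputable def cutoffMul (h : ℝ → ℂ) (hh : ContDiff ℝ ∞ h) : 𝓢(ℝ, ℂ) :=
  HasCompactSupport.toSchwartzMap (f := fun x => cutoff x • h x)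
    cutoff.hasCompactSupport.smul_right (cutoff.contDiff.smul hh)

theorem cutoffMul_apply (h : ℝ → ℂ) (hh : ContDiff ℝ ∞ h) (x : ℝ) :
    cutoffMul h hh x = cutoff x • h x := rfl

theorem HTilde.memSobolev {u : 𝓢'(ℝ, ℂ)} (hu : u ∈ HTilde (-1 / 2)) : MemSobolev (-1) 2 u :=
  hu.1.mono (by norm_num)

theorem HTilde.apply_eq_zero {u : 𝓢'(ℝ, ℂ)} (hu : u ∈ HTilde (-1 / 2)) {ψ : 𝓢(ℝ, ℂ)} {U : Set ℝ}
    (hU : IsOpen U) (hsub : Set.Icc (-1) 1 ⊆ U) (h0 : ∀ x ∈ U, ψ x = 0) : u ψ = 0 := by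
  refine apply_eq_zero_of_tsupport_subset (HTilde.memSobolev hu) hu.2 ?_
  have : tsupport ψ ⊆ Uᶜ :=
    closure_minimal (fun x hx hxU => hx (h0 x hxU)) hU.isClosed_compl
  exact this.trans (Set.compl_subset_compl.2 hsub)

theorem HTilde.apply_eq {u : 𝓢'(ℝ, ℂ)} (hu : u ∈ HTilde (-1 / 2)) {ψ χ : 𝓢(ℝ, ℂ)} {U : Set ℝ}
    (hU : IsOpen U) (hsub : Set.Icc (-1) 1 ⊆ U) (h0 : ∀ x ∈ U, ψ x = χ x) : u ψ = u χ := by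
  rw [← sub_eq_zero, ← map_sub]
  refine HTilde.apply_eq_zero hu hU hsub fun x hx => ?_
  rw [_root_.sub_apply, h0 x hx, sub_self]

/-- The primitive of a Schwartz function vanishing at the origin. -/
noncomputable def primitive (ψ : 𝓢(ℝ, ℂ)) (x : ℝ) : ℂ := ∫ t in (0 : ℝ)..x, ψ t

theorem hasDerivAt_primitive (ψ : 𝓢(ℝ, ℂ)) (x : ℝ) : HasDerivAt (primitive ψ) (ψ x) x :=
  intervalIntegral.integral_hasDerivAt_right (ψ.continuous.intervalIntegrable _ _)
    (ψ.continuous.stronglyMeasurableAtFilter _ _) ψ.continuous.continuousAt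

theorem contDiff_primitive (ψ : 𝓢(ℝ, ℂ)) : ContDiff ℝ ∞ (primitive ψ) := by
  rw [contDiff_infty_iff_deriv]
  refine ⟨fun x => (hasDerivAt_primitive ψ x).differentiableAt, ?_⟩
  rw [funext fun x => (hasDerivAt_primitive ψ x).deriv]
  exact ψ.smooth ⊤

/-- Cauchy–Schwarz on an interval of length at most `3`, the radius of the support of `cutoff`. -/
theorem norm_primitive_le (ψ : 𝓢(ℝ, ℂ)) {x : ℝ} (hx : |x| ≤ 3) :
    ‖primitive ψ x‖ ≤ Real.sqrt 3 * ‖ψ.toLp 2‖ := by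
  have h1 : ‖primitive ψ x‖ ≤ ∫ t in Set.uIoc 0 x, ‖ψ t‖ := by
    exact intervalIntegral.norm_integral_le_integral_norm_uIoc
  have h2 := integral_mul_le_Lp_mul_Lq_of_nonneg (μ := volume.restrict (Set.uIoc 0 x))
    (p := 2) (q := 2) (f := fun _ => (1 : ℝ)) (g := fun t => ‖ψ t‖)
    ⟨by norm_num, by norm_num, by norm_num⟩ (.of_forall fun _ => zero_le_one)
    (.of_forall fun _ => norm_nonneg _) ?_ ?_
  · simp only [one_mul, Real.one_rpow, integral_const, smul_eq_mul, mul_one] at h2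
    refine h1.trans (h2.trans ?_)
    have hvol : (volume.restrict (Set.uIoc 0 x)).real Set.univ ≤ 3 := by
      rw [measureReal_restrict_apply_univ, Set.uIoc, Real.volume_real_Ioc_of_le (by simp)]
      rw [max_sub_min_eq_abs']
      simpa using hx
    have hn : ‖ψ.toLp 2‖ = (∫ t, ‖ψ t‖ ^ (2 : ℝ)) ^ (1 / 2 : ℝ) := by
      rw [SchwartzMap.norm_toLp' (by simp) (by simp)]
      simp
    rw [hn, Real.sqrt_eq_rpow]
    gcongr
    · exact .of_forall fun t => by positivity
    · have := (ψ.memLp 2).integrable_norm_rpow (by simp) (by simp)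
      simpa using this
    · exact Measure.restrict_le_self
  · simp only [ENNReal.ofReal_ofNat]
    have : IsFiniteMeasure (volume.restrict (Set.uIoc 0 x)) := by
      rw [Set.uIoc]
      infer_instance
    exact memLp_const 1
  · simp only [ENNReal.ofReal_ofNat]
    exact ((ψ.memLp 2).restrict _).norm

end FlatScreen

/-! ### The square integrable primitive -/

namespace FlatScreen

open FourierTransform Filter Topology

/-- A linear form on Schwartz functions that is bounded for the `L²` norm is given by a square
integrable function. -/
theorem exists_Lp_representative (L : 𝓢(ℝ, ℂ) →ₗ[ℂ] ℂ)
    (hL : ∃ C, ∀ ψ : 𝓢(ℝ, ℂ), ‖L ψ‖ ≤ C * ‖ψ.toLp 2 volume‖) :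
    ∃ v : Lp ℂ 2 (volume : Measure ℝ), ∀ ψ : 𝓢(ℝ, ℂ), L ψ = ∫ x, ψ x * v x := by
  set e : 𝓢(ℝ, ℂ) →ₗ[ℂ] Lp ℂ 2 (volume : Measure ℝ) :=
    (SchwartzMap.toLpCLM ℂ ℂ 2 volume).toLinearMap with he
  have hd : DenseRange e := SchwartzMap.denseRange_toLpCLM ENNReal.ofNat_ne_top
  have hb : ∃ C, ∀ ψ, ‖L ψ‖ ≤ C * ‖e ψ‖ := hL
  set w := (InnerProductSpace.toDual ℂ (Lp ℂ 2 (volume : Measure ℝ))).symm (L.extendOfNorm e)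
  -- The Riesz vector enters the inner product conjugated, so the representing function is its
  -- conjugate.
  refine ⟨(Lp.memLp w).star.toLp, fun ψ => ?_⟩
  rw [← LinearMap.extendOfNorm_eq hd hb ψ, ← InnerProductSpace.toDual_symm_apply, L2.inner_def]
  refine integral_congr_ae ?_
  filter_upwards [(Lp.memLp w).star.coeFn_toLp, ψ.coeFn_toLp 2 volume] with x h1 h2
  rw [h1]
  change inner ℂ (w x) (ψ.toLp 2 volume x) = _
  rw [h2]
  simp [w]

theorem deriv_cutoff_eq_zero {x : ℝ} (hx : x ∉ Set.Icc (-3) 3) : deriv cutoff x = 0 := by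
  refine image_eq_zero_of_notMem_tsupport fun h => hx ?_
  have := tsupport_deriv_subset h
  rw [cutoff.tsupport_eq, Metric.mem_closedBall, dist_zero_right, Real.norm_eq_abs] at this
  exact abs_le.1 this

theorem cutoff_eq_zero {x : ℝ} (hx : x ∉ Set.Icc (-3) 3) : cutoff x = 0 := by
  refine image_eq_zero_of_notMem_tsupport fun h => hx ?_
  rw [cutoff.tsupport_eq, Metric.mem_closedBall, dist_zero_right, Real.norm_eq_abs] at h
  exact abs_le.1 h

theorem cutoff_eq_one_of_mem_Ioo {x : ℝ} (hx : x ∈ Set.Ioo (-2) 2) : cutoff x = 1 := by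
  refine cutoff.one_of_mem_closedBall ?_
  rw [Metric.mem_closedBall, dist_zero_right, Real.norm_eq_abs]
  exact (abs_lt.2 hx).le

theorem deriv_cutoffMul_primitive (ψ : 𝓢(ℝ, ℂ)) (x : ℝ) :
    deriv (cutoffMul (primitive ψ) (contDiff_primitive ψ)) x =
      cutoff x • ψ x + deriv cutoff x • primitive ψ x :=
  (((contDiff_infty_iff_deriv.1 contDiff_cutoff).1 x).hasDerivAt.smul
    (hasDerivAt_primitive ψ x)).deriv

/-- The linear form `ψ ↦ ⟨u, cutoff · ∫₀ ψ⟩`. -/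
noncomputable def primitiveForm (u : 𝓢'(ℝ, ℂ)) : 𝓢(ℝ, ℂ) →ₗ[ℂ] ℂ where
  toFun ψ := u (cutoffMul (primitive ψ) (contDiff_primitive ψ))
  map_add' ψ χ := by
    rw [← map_add]
    congr 1
    ext x
    simp only [cutoffMul_apply, _root_.add_apply, primitive]
    rw [intervalIntegral.integral_add (ψ.continuous.intervalIntegrable _ _)
      (χ.continuous.intervalIntegrable _ _), smul_add]
  map_smul' c ψ := by
    rw [RingHom.id_apply, ← map_smul]
    congr 1
    ext x
    simp only [cutoffMul_apply, _root_.smul_apply, primitive, intervalIntegral.integral_smul]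
    rw [smul_comm]

theorem primitiveForm_apply (u : 𝓢'(ℝ, ℂ)) (ψ : 𝓢(ℝ, ℂ)) :
    primitiveForm u ψ = u (cutoffMul (primitive ψ) (contDiff_primitive ψ)) := rfl

/-- Taking a primitive makes up for the derivative in the representation of `u`: the derivative of
`cutoff · ∫₀ ψ` is `cutoff · ψ + cutoff' · ∫₀ ψ`, and both terms are controlled by the `L²` norm of
`ψ`. -/
theorem exists_norm_primitiveForm_le {u : 𝓢'(ℝ, ℂ)} (hu : MemSobolev (-1) 2 u) :
    ∃ C, ∀ ψ : 𝓢(ℝ, ℂ), ‖primitiveForm u ψ‖ ≤ C * ‖ψ.toLp 2 volume‖ := by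
  obtain ⟨a, b, hab⟩ := exists_L2_decomposition hu
  obtain ⟨M, hM⟩ := exists_abs_deriv_cutoff_le
  have hM0 : 0 ≤ M := (abs_nonneg _).trans (hM 0)
  have hloc (f : Lp ℂ 2 (volume : Measure ℝ)) :
      Integrable ((Set.Icc (-3 : ℝ) 3).indicator fun x => ‖f x‖) :=
    IntegrableOn.integrable_indicator (((Lp.memLp f).locallyIntegrable
      (by norm_num)).integrableOn_isCompact isCompact_Icc).norm measurableSet_Icc
  set A : ℝ := ∫ x, (Set.Icc (-3 : ℝ) 3).indicator (fun x => ‖a x‖) x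
  set B : ℝ := ∫ x, (Set.Icc (-3 : ℝ) 3).indicator (fun x => ‖b x‖) x
  refine ⟨Real.sqrt 3 * A + (M * Real.sqrt 3 * B + (∫ x, ‖b x‖ ^ (2 : ℝ)) ^ (1 / 2 : ℝ)),
    fun ψ => ?_⟩
  set N := ‖ψ.toLp 2 volume‖ with hN
  have hN' : N = (∫ t, ‖ψ t‖ ^ (2 : ℝ)) ^ (1 / 2 : ℝ) := by
    rw [hN, SchwartzMap.norm_toLp' (by simp) (by simp)]
    simp
  have hψb : Integrable fun x => ‖ψ x‖ * ‖b x‖ := by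
    simpa only [norm_mul] using (integrable_schwartz_mul ψ b).norm
  have h3 : ∫ x, ‖ψ x‖ * ‖b x‖ ≤ N * (∫ x, ‖b x‖ ^ (2 : ℝ)) ^ (1 / 2 : ℝ) := by
    rw [hN']
    refine integral_mul_le_Lp_mul_Lq_of_nonneg ⟨by norm_num, by norm_num, by norm_num⟩
      (.of_forall fun _ => norm_nonneg _) (.of_forall fun _ => norm_nonneg _) ?_ ?_
    · simpa using (ψ.memLp 2).norm
    · simpa using (Lp.memLp b).norm
  rw [primitiveForm_apply, hab]
  have h1 : ‖∫ x, cutoffMul (primitive ψ) (contDiff_primitive ψ) x * a x‖ ≤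
      Real.sqrt 3 * N * A := by
    rw [← integral_const_mul]
    refine norm_integral_le_of_norm_le ((hloc a).const_mul _) (.of_forall fun x => ?_)
    rw [cutoffMul_apply, norm_mul, norm_smul]
    by_cases hx : x ∈ Set.Icc (-3 : ℝ) 3
    · rw [Set.indicator_of_mem hx]
      refine mul_le_mul_of_nonneg_right ?_ (norm_nonneg _)
      exact (mul_le_of_le_one_left (norm_nonneg _) (abs_cutoff_le_one x)).trans
        (norm_primitive_le ψ (abs_le.2 hx))
    · rw [cutoff_eq_zero hx, Set.indicator_of_notMem hx]
      simp
  have h2 : ‖∫ x, deriv (cutoffMul (primitive ψ) (contDiff_primitive ψ)) x * b x‖ ≤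
      M * (Real.sqrt 3 * N) * B + ∫ x, ‖ψ x‖ * ‖b x‖ := by
    rw [← integral_const_mul, ← integral_add ((hloc b).const_mul _) hψb]
    refine norm_integral_le_of_norm_le (((hloc b).const_mul _).add hψb) (.of_forall fun x => ?_)
    rw [deriv_cutoffMul_primitive, add_mul, add_comm]
    refine (norm_add_le _ _).trans (add_le_add ?_ ?_)
    · rw [norm_mul, norm_smul]
      by_cases hx : x ∈ Set.Icc (-3 : ℝ) 3
      · rw [Set.indicator_of_mem hx]
        refine mul_le_mul_of_nonneg_right ?_ (norm_nonneg _)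
        exact mul_le_mul (hM x) (norm_primitive_le ψ (abs_le.2 hx)) (norm_nonneg _) hM0
      · rw [deriv_cutoff_eq_zero hx, Set.indicator_of_notMem hx]
        simp
    · rw [norm_mul, norm_smul]
      refine mul_le_mul_of_nonneg_right ?_ (norm_nonneg _)
      exact mul_le_of_le_one_left (norm_nonneg _) (abs_cutoff_le_one x)
  refine (norm_add_le _ _).trans ((add_le_add h1 (h2.trans (add_le_add_right h3 _))).trans_eq ?_)
  ring

theorem exists_Ioo_subset_of_Icc_subset {U : Set ℝ} (hU : IsOpen U) (h : Set.Icc (-1) 1 ⊆ U) :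
    ∃ δ > 0, Set.Ioo (-1 - δ) (1 + δ) ⊆ U := by
  obtain ⟨δ, hδ, hsub⟩ := isCompact_Icc.exists_thickening_subset_open hU h
  refine ⟨δ, hδ, fun x hx => hsub ?_⟩
  rw [Metric.mem_thickening_iff]
  rcases lt_or_ge x (-1) with h1 | h1
  · refine ⟨-1, by simp, ?_⟩
    rw [Real.dist_eq, abs_lt]
    constructor <;> linarith [hx.1]
  rcases le_or_gt x 1 with h2 | h2
  · exact ⟨x, ⟨h1, h2⟩, by simpa using hδ⟩
  · refine ⟨1, by simp, ?_⟩
    rw [Real.dist_eq, abs_lt]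
    constructor <;> linarith [hx.2]

/-- An element `u` of `H̃^{-1/2}(-1, 1)` is, up to its mean, the derivative of a square integrable
function supported in `[-1, 1]`. -/
theorem exists_L2_primitive {u : 𝓢'(ℝ, ℂ)} (hu : u ∈ HTilde (-1 / 2)) :
    ∃ v : Lp ℂ 2 (volume : Measure ℝ), (∀ᵐ x, x ∉ Set.Icc (-1 : ℝ) 1 → v x = 0) ∧
      ∀ ψ : 𝓢(ℝ, ℂ), u ψ = ψ 0 * u (cutoffMul (fun _ => 1) contDiff_const) +
        ∫ x, deriv ψ x * v x := by
  obtain ⟨v, hv⟩ := exists_Lp_representative _ (exists_norm_primitiveForm_le (HTilde.memSobolev hu))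
  refine ⟨v, ?_, fun ψ => ?_⟩
  · refine isClosed_Icc.isOpen_compl.ae_eq_zero_of_integral_contDiff_smul_eq_zero
      (((Lp.memLp v).locallyIntegrable (by norm_num)).locallyIntegrableOn _) fun g hg hgc hgs => ?_
    have hgc' : HasCompactSupport fun x => (g x : ℂ) := hgc.comp_left (g := ((↑) : ℝ → ℂ)) rfl
    set ψ : 𝓢(ℝ, ℂ) := hgc'.toSchwartzMap (Complex.ofRealCLM.contDiff.comp hg) with hψ
    have hψ' (x : ℝ) : ψ x = (g x : ℂ) := rfl
    have h := hv ψ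
    rw [primitiveForm_apply] at h
    simp only [Complex.real_smul]
    refine h.symm.trans ?_
    -- The primitive is based at `0`, inside the segment. If `g` vanishes near `[-1, 1]`, so does
    -- its primitive, and `u` does not see it.
    obtain ⟨δ, hδ, hsub⟩ := exists_Ioo_subset_of_Icc_subset
      (isClosed_tsupport g).isOpen_compl (Set.subset_compl_comm.1 hgs)
    refine HTilde.apply_eq_zero hu isOpen_Ioo (U := Set.Ioo (-1 - δ) (1 + δ))
      (Set.Icc_subset_Ioo (by linarith) (by linarith)) fun x hx => ?_
    rw [cutoffMul_apply, primitive, intervalIntegral.integral_zero_ae, smul_zero]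
    refine .of_forall fun t ht => ?_
    have ht' : t ∈ Set.Ioo (-1 - δ) (1 + δ) :=
      Set.ordConnected_Ioo.uIcc_subset ⟨by linarith, by linarith⟩ hx (Set.uIoc_subset_uIcc ht)
    rw [hψ', image_eq_zero_of_notMem_tsupport (hsub ht'), Complex.ofReal_zero]
  · have h := hv (SchwartzMap.derivCLM ℂ ℂ ψ)
    rw [primitiveForm_apply] at h
    change _ = ∫ x, deriv ψ x * v x at h
    rw [← h, ← smul_eq_mul, ← map_smul, ← map_add]
    -- Near `[-1, 1]` the cutoff is `1` and the identity is `ψ = ψ(0) + ∫₀ ψ'`.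
    refine HTilde.apply_eq hu (isOpen_Ioo (a := -2) (b := 2))
      (Set.Icc_subset_Ioo (by norm_num) (by norm_num)) fun x hx => ?_
    rw [_root_.add_apply, _root_.smul_apply, cutoffMul_apply, cutoffMul_apply,
      cutoff_eq_one_of_mem_Ioo hx, one_smul, one_smul, smul_eq_mul, mul_one, primitive]
    have : ∫ t in (0 : ℝ)..x, (SchwartzMap.derivCLM ℂ ℂ ψ) t = ψ x - ψ 0 :=
      intervalIntegral.integral_eq_sub_of_hasDerivAt (fun t _ => ψ.hasDerivAt t)
        ((SchwartzMap.derivCLM ℂ ℂ ψ).continuous.intervalIntegrable _ _)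
    rw [this]
    ring

end FlatScreen

/-! ### The derivative of the potential as a Hilbert transform -/

namespace FlatScreen

open FourierTransform Filter Topology

/-- A test function on `(-1, 1)`, as a Schwartz function. -/
noncomputable def testToSchwartz (φ : 𝓓(segmentInterior, ℂ)) : 𝓢(ℝ, ℂ) :=
  φ.hasCompactSupport.toSchwartzMap φ.contDiff

theorem testToSchwartz_apply (φ : 𝓓(segmentInterior, ℂ)) (x : ℝ) : testToSchwartz φ x = φ x := rfl

theorem hasDerivAt_testFunction (φ : 𝓓(segmentInterior, ℂ)) (x : ℝ) :
    HasDerivAt φ (deriv φ x) x :=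
  (testToSchwartz φ).hasDerivAt x

theorem continuous_deriv_testFunction (φ : 𝓓(segmentInterior, ℂ)) : Continuous (deriv φ) :=
  (SchwartzMap.derivCLM ℂ ℂ (testToSchwartz φ)).continuous

theorem deriv_potential (φ : 𝓓(segmentInterior, ℂ)) (x : ℝ) :
    deriv (potential φ) x = ∫ y, greenKernel (x - y) • deriv φ y := by
  have h : potential φ = greenKernel ⋆[ContinuousLinearMap.lsmul ℝ ℝ, volume] φ := by
    funext x
    rw [convolution_eq_swap]
    rfl
  rw [h, (HasCompactSupport.hasDerivAt_convolution_right _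
    locallyIntegrable_greenKernel φ.hasCompactSupport (φ.contDiff.of_le (by simp)) x).deriv, convolution_eq_swap]
  rfl

/-- The symbol of the Hilbert transform, up to a factor. -/
noncomputable def signSymbol (ξ : ℝ) : ℂ := if 0 < ξ then 1 else -1

theorem norm_signSymbol (ξ : ℝ) : ‖signSymbol ξ‖ = 1 := by
  unfold signSymbol
  split_ifs <;> simp

theorem measurable_signSymbol : Measurable signSymbol :=
  Measurable.ite measurableSet_Ioi measurable_const measurable_const

/-- The regularised kernel of the derivative of the single-layer potential, in the Fourier
domain. -/
noncomputable def regularizedKernel (ε x ξ : ℝ) : ℂ :=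
  signSymbol ξ * (Complex.exp ((-(2 * Real.pi * ε * |ξ|) : ℝ)) *
    Complex.exp ((2 * Real.pi * x * ξ : ℝ) * Complex.I))

theorem norm_regularizedKernel (ε x ξ : ℝ) :
    ‖regularizedKernel ε x ξ‖ = Real.exp (-(2 * Real.pi * ε * |ξ|)) := by
  rw [regularizedKernel, norm_mul, norm_mul, norm_signSymbol, Complex.norm_exp_ofReal_mul_I,
    ← Complex.ofReal_exp, Complex.norm_real, Real.norm_eq_abs, Real.abs_exp]
  ring

theorem measurable_regularizedKernel (ε x : ℝ) : Measurable (regularizedKernel ε x) :=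
  measurable_signSymbol.mul (by fun_prop)

theorem regularizedKernel_of_pos (ε x : ℝ) {ξ : ℝ} (hξ : 0 < ξ) : regularizedKernel ε x ξ =
    Complex.exp ((-(2 * Real.pi * ε) + 2 * Real.pi * x * Complex.I) * ξ) := by
  rw [regularizedKernel, signSymbol, if_pos hξ, one_mul, ← Complex.exp_add, abs_of_pos hξ]
  congr 1
  push_cast
  ring

theorem regularizedKernel_of_nonpos (ε x : ℝ) {ξ : ℝ} (hξ : ξ ≤ 0) : regularizedKernel ε x ξ =
    -Complex.exp ((2 * Real.pi * ε + 2 * Real.pi * x * Complex.I) * ξ) := by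
  rw [regularizedKernel, signSymbol, if_neg hξ.not_gt, ← Complex.exp_add, abs_of_nonpos hξ]
  rw [neg_one_mul]
  congr 2
  push_cast
  ring

/-- Two exponential integrals, one on each half-line. The result is a conjugate Poisson kernel,
which replaces the principal value of `1/x` by an honest function. -/
theorem integrable_regularizedKernel_and_integral {ε : ℝ} (hε : 0 < ε) (x : ℝ) :
    Integrable (regularizedKernel ε x) ∧ ∫ ξ, regularizedKernel ε x ξ =
      Complex.I / Real.pi * ((x / (x ^ 2 + ε ^ 2) : ℝ) : ℂ) := by
  set a : ℂ := -(2 * Real.pi * ε) + 2 * Real.pi * x * Complex.I with ha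
  set b : ℂ := 2 * Real.pi * ε + 2 * Real.pi * x * Complex.I with hb
  have hare : a.re < 0 := by
    simp only [ha, Complex.add_re, Complex.neg_re, Complex.mul_re, Complex.re_ofNat,
      Complex.ofReal_re, Complex.im_ofNat, Complex.ofReal_im, Complex.I_re, Complex.I_im,
      Complex.mul_im]
    have := mul_pos Real.pi_pos hε
    ring_nf
    linarith
  have hbre : 0 < b.re := by
    simp only [hb, Complex.add_re, Complex.mul_re, Complex.re_ofNat,
      Complex.ofReal_re, Complex.im_ofNat, Complex.ofReal_im, Complex.I_re, Complex.I_im,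
      Complex.mul_im]
    have := mul_pos Real.pi_pos hε
    ring_nf
    linarith
  have ha0 : a ≠ 0 := fun h => by simp [h] at hare
  have hb0 : b ≠ 0 := fun h => by simp [h] at hbre
  have h1 : Set.EqOn (regularizedKernel ε x) (fun ξ : ℝ => Complex.exp (a * ξ)) (Set.Ioi 0) :=
    fun ξ hξ => regularizedKernel_of_pos ε x hξ
  have h2 : Set.EqOn (regularizedKernel ε x) (fun ξ : ℝ => -Complex.exp (b * ξ)) (Set.Iic 0) :=
    fun ξ hξ => regularizedKernel_of_nonpos ε x hξ
  have i1 : IntegrableOn (regularizedKernel ε x) (Set.Ioi 0) :=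
    (integrableOn_congr_fun h1 measurableSet_Ioi).2 (integrableOn_exp_mul_complex_Ioi hare 0)
  have i2 : IntegrableOn (regularizedKernel ε x) (Set.Iic 0) :=
    (integrableOn_congr_fun h2 measurableSet_Iic).2 (integrableOn_exp_mul_complex_Iic hbre 0).neg
  refine ⟨?_, ?_⟩
  · rw [← integrableOn_univ, ← Set.Iic_union_Ioi (a := (0 : ℝ))]
    exact i2.union i1
  rw [← intervalIntegral.integral_Iic_add_Ioi i2 i1, setIntegral_congr_fun measurableSet_Ioi h1,
    setIntegral_congr_fun measurableSet_Iic h2, integral_neg, integral_exp_mul_complex_Ioi hare,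
    integral_exp_mul_complex_Iic hbre]
  simp only [Complex.ofReal_zero, mul_zero, Complex.exp_zero]
  have hpos : ((x : ℂ) ^ 2 + ε ^ 2) ≠ 0 := by
    have : x ^ 2 + ε ^ 2 ≠ 0 := by positivity
    exact_mod_cast this
  have hpi : (Real.pi : ℂ) ≠ 0 := by exact_mod_cast Real.pi_ne_zero
  push_cast
  have hab : a * b = -(4 * Real.pi ^ 2 * (x ^ 2 + ε ^ 2)) := by
    rw [ha, hb]
    linear_combination (4 * (Real.pi : ℂ) ^ 2 * x ^ 2) * Complex.I_sq
  have hsum : a + b = 4 * Real.pi * x * Complex.I := by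
    rw [ha, hb]
    ring
  have : -(1 / b) + -1 / a = -(a + b) / (a * b) := by
    field_simp
    ring
  rw [this, hab, hsum]
  field_simp

theorem fourier_regularizedKernel (ε x y : ℝ) :
    𝓕 (regularizedKernel ε x) y = ∫ ξ, regularizedKernel ε (x - y) ξ := by
  rw [Real.fourier_real_eq_integral_exp_smul]
  refine integral_congr_ae (.of_forall fun ξ => ?_)
  simp only [regularizedKernel, smul_eq_mul]
  rw [mul_left_comm, mul_left_comm (Complex.exp _) (Complex.exp _), ← Complex.exp_add]
  congr 3
  push_cast
  ring

theorem integral_fourier_mul_regularizedKernel {f : ℝ → ℂ} (hf : Integrable f) {ε : ℝ}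
    (hε : 0 < ε) (x : ℝ) : ∫ ξ, 𝓕 f ξ * regularizedKernel ε x ξ =
      ∫ y, f y * (Complex.I / Real.pi * (((x - y) / ((x - y) ^ 2 + ε ^ 2) : ℝ) : ℂ)) := by
  rw [integral_fourier_mul_eq hf (integrable_regularizedKernel_and_integral hε x).1]
  refine integral_congr_ae (.of_forall fun y => ?_)
  simp only
  rw [fourier_regularizedKernel, (integrable_regularizedKernel_and_integral hε _).2]

/-- The kernel `t/(t² + ε²)` is the derivative of `log (t² + ε²)/2`. Moving the derivative onto `φ`
leaves a kernel that converges to `log |t|` with an integrable majorant on compact sets. -/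
theorem integral_testFunction_mul_kernel (φ : 𝓓(segmentInterior, ℂ)) {ε : ℝ} (hε : 0 < ε) (x : ℝ) :
    ∫ y, (((x - y) / ((x - y) ^ 2 + ε ^ 2) : ℝ) : ℂ) * φ y =
      ∫ y, ((Real.log ((x - y) ^ 2 + ε ^ 2) / 2 : ℝ) : ℂ) * deriv φ y := by
  have hne (y : ℝ) : (x - y) ^ 2 + ε ^ 2 ≠ 0 := by positivity
  have hu (y : ℝ) : HasDerivAt (fun y => ((Real.log ((x - y) ^ 2 + ε ^ 2) / 2 : ℝ) : ℂ))
      (-(((x - y) / ((x - y) ^ 2 + ε ^ 2) : ℝ) : ℂ)) y := by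
    have h1 : HasDerivAt (fun y => Real.log ((x - y) ^ 2 + ε ^ 2) / 2)
        (-((x - y) / ((x - y) ^ 2 + ε ^ 2))) y := by
      have h2 : HasDerivAt (fun y => (x - y) ^ 2 + ε ^ 2) (2 * (x - y) * (-1)) y := by
        simpa using! (((hasDerivAt_id y).const_sub x).pow 2).add_const (ε ^ 2)
      refine ((h2.log (hne y)).div_const 2).congr_deriv ?_
      field_simp
    exact_mod_cast h1.ofReal_comp
  have hc1 : Continuous fun y : ℝ => ((Real.log ((x - y) ^ 2 + ε ^ 2) / 2 : ℝ) : ℂ) :=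
    continuous_iff_continuousAt.2 fun y => (hu y).continuousAt
  have hc2 : Continuous fun y : ℝ => -(((x - y) / ((x - y) ^ 2 + ε ^ 2) : ℝ) : ℂ) :=
    (Complex.continuous_ofReal.comp (by fun_prop (disch := exact hne _))).neg
  have h := integral_mul_deriv_eq_deriv_mul_of_integrable (v := φ) (v' := deriv φ)
    (fun y _ => hu y) (fun y _ => hasDerivAt_testFunction φ y)
    ((hc1.mul (continuous_deriv_testFunction φ)).integrable_of_hasCompactSupport
      φ.hasCompactSupport.deriv.mul_left)
    ((hc2.mul φ.continuous).integrable_of_hasCompactSupport φ.hasCompactSupport.mul_left)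
    ((hc1.mul φ.continuous).integrable_of_hasCompactSupport φ.hasCompactSupport.mul_left)
  rw [h, ← integral_neg]
  simp

/-- A majorant independent of `ε`: the logarithm is bounded below by monotonicity and above by `log
s ≤ s - 1`. -/
theorem abs_log_sq_add_sq_le {t ε : ℝ} (ht : t ≠ 0) (hε : ε ^ 2 ≤ 1) :
    |Real.log (t ^ 2 + ε ^ 2) / 2| ≤ |Real.log (|t|)| + t ^ 2 := by
  have ht2 : 0 < t ^ 2 := by positivity
  have h0 : Real.log (t ^ 2) = 2 * Real.log |t| := by
    rw [← sq_abs, Real.log_pow]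
    norm_num
  have h1 : Real.log (t ^ 2) ≤ Real.log (t ^ 2 + ε ^ 2) :=
    Real.log_le_log ht2 (by linarith [sq_nonneg ε])
  have h2 : Real.log (t ^ 2 + ε ^ 2) ≤ t ^ 2 :=
    (Real.log_le_sub_one_of_pos (by positivity)).trans (by linarith)
  rw [abs_le]
  constructor <;> linarith [neg_abs_le (Real.log |t|), abs_nonneg (Real.log |t|)]

/-- The derivative of the potential is a Hilbert transform of the test function. -/
theorem deriv_potential_eq_integral (φ : 𝓓(segmentInterior, ℂ)) (x : ℝ) :
    deriv (potential φ) x = Complex.I / 2 *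
      ∫ ξ, 𝓕 (φ : ℝ → ℂ) ξ * (signSymbol ξ * Complex.exp ((2 * Real.pi * x * ξ : ℝ) * Complex.I)) := by
  have hφi : Integrable (φ : ℝ → ℂ) := (testToSchwartz φ).integrable
  have hφF : Integrable (𝓕 (φ : ℝ → ℂ)) := (𝓕 (testToSchwartz φ)).integrable
  have hφd := continuous_deriv_testFunction φ
  let r : ℕ → ℝ := fun n => 1 / ((n : ℝ) + 1)
  have hr0 : ∀ n, 0 < r n := fun n => by positivity
  have hr1 : ∀ n, r n ^ 2 ≤ 1 := fun n => by
    refine pow_le_one₀ (hr0 n).le ?_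
    rw [div_le_one (by positivity)]
    linarith [n.cast_nonneg (α := ℝ)]
  have hr : Tendsto r atTop (𝓝 0) := tendsto_one_div_add_atTop_nhds_zero_nat
  have hlim1 : Tendsto (fun n => ∫ ξ, 𝓕 (φ : ℝ → ℂ) ξ * regularizedKernel (r n) x ξ) atTop
      (𝓝 (∫ ξ, 𝓕 (φ : ℝ → ℂ) ξ *
        (signSymbol ξ * Complex.exp ((2 * Real.pi * x * ξ : ℝ) * Complex.I)))) := by
    refine tendsto_integral_of_dominated_convergence _ (fun n => ?_) hφF.norm
      (fun n => .of_forall fun ξ => ?_) (.of_forall fun ξ => ?_)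
    · exact hφF.aestronglyMeasurable.mul (measurable_regularizedKernel _ _).aestronglyMeasurable
    · rw [norm_mul, norm_regularizedKernel]
      refine mul_le_of_le_one_right (norm_nonneg _) (Real.exp_le_one_iff.2 ?_)
      have := hr0 n
      have : 0 ≤ 2 * Real.pi * r n * |ξ| := by positivity
      linarith
    · refine Tendsto.const_mul _ (Tendsto.const_mul _ ?_)
      have : Tendsto (fun n => Complex.exp ((-(2 * Real.pi * r n * |ξ|) : ℝ))) atTop (𝓝 1) := by
        have h2 : Continuous fun s : ℝ => Complex.exp ((-(2 * Real.pi * s * |ξ|) : ℝ)) := by fun_prop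
        simpa [Function.comp_def] using (h2.tendsto 0).comp hr
      simpa using this.mul_const (Complex.exp ((2 * Real.pi * x * ξ : ℝ) * Complex.I))
  have hlim2 : Tendsto (fun n => ∫ y, ((Real.log ((x - y) ^ 2 + r n ^ 2) / 2 : ℝ) : ℂ) * deriv φ y)
      atTop (𝓝 (∫ y, ((Real.log |x - y| : ℝ) : ℂ) * deriv φ y)) := by
    have hne : ∀ᵐ y : ℝ, x - y ≠ 0 := by
      filter_upwards [Measure.ae_ne volume x] with y hy
      exact sub_ne_zero.2 hy.symm
    have hcpt (F : ℝ → ℝ) (hF : LocallyIntegrable F) :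
        Integrable fun y => F (x - y) * ‖deriv φ y‖ := by
      have := φ.hasCompactSupport.deriv.norm.convolutionExists_right
        (ContinuousLinearMap.lsmul ℝ ℝ) hF hφd.norm x
      simpa using! ConvolutionExistsAt.integrable_swap this
    have hlog : LocallyIntegrable fun t : ℝ => |Real.log (|t|)| := by
      refine (locallyIntegrable_greenKernel.smul (-(2 * Real.pi))).mono
        (Measurable.aestronglyMeasurable (by fun_prop)) (.of_forall fun t => le_of_eq ?_)
      simp only [Pi.smul_apply, greenKernel, smul_eq_mul, Real.norm_eq_abs, abs_abs]
      congr 1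
      field_simp
    have hsq : LocallyIntegrable fun t : ℝ => t ^ 2 := (continuous_pow 2).locallyIntegrable
    refine tendsto_integral_of_dominated_convergence
      (fun y => (|Real.log (|x - y|)| + (x - y) ^ 2) * ‖deriv φ y‖) (fun n => ?_)
      (hcpt _ (hlog.add hsq)) (fun n => ?_) ?_
    · refine AEStronglyMeasurable.mul ?_ hφd.aestronglyMeasurable
      exact Measurable.aestronglyMeasurable (by fun_prop)
    · filter_upwards [hne] with y hy
      rw [norm_mul, Complex.norm_real, Real.norm_eq_abs]
      exact mul_le_mul_of_nonneg_right (abs_log_sq_add_sq_le hy (hr1 n)) (norm_nonneg _)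
    · filter_upwards [hne] with y hy
      refine Tendsto.mul_const _ ((Complex.continuous_ofReal.tendsto _).comp ?_)
      have h1 : Tendsto (fun n => Real.log ((x - y) ^ 2 + r n ^ 2) / 2) atTop
          (𝓝 (Real.log ((x - y) ^ 2 + 0 ^ 2) / 2)) :=
        ((tendsto_const_nhds.add (hr.pow 2)).log (by positivity)).div_const 2
      convert h1 using 2
      rw [zero_pow two_ne_zero, add_zero, ← sq_abs, Real.log_pow]
      push_cast
      ring
  -- The constants match because `(i/2)(i/π) = -1/(2π)`, the factor in `greenKernel`.
  have hn (n : ℕ) : Complex.I / 2 * ∫ ξ, 𝓕 (φ : ℝ → ℂ) ξ * regularizedKernel (r n) x ξ =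
      -(1 / (2 * Real.pi)) *
        ∫ y, ((Real.log ((x - y) ^ 2 + r n ^ 2) / 2 : ℝ) : ℂ) * deriv φ y := by
    rw [integral_fourier_mul_regularizedKernel hφi (hr0 n), ← integral_testFunction_mul_kernel φ
      (hr0 n), ← integral_const_mul, ← integral_const_mul]
    refine integral_congr_ae (.of_forall fun y => ?_)
    simp only
    have hpi : (Real.pi : ℂ) ≠ 0 := by exact_mod_cast Real.pi_ne_zero
    field_simp
    linear_combination φ y * (((x - y) / ((x - y) ^ 2 + r n ^ 2) : ℝ) : ℂ) * Complex.I_sq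
  have h1 := hlim1.const_mul (Complex.I / 2)
  simp only [hn] at h1
  rw [tendsto_nhds_unique h1 (hlim2.const_mul _), deriv_potential, ← integral_const_mul]
  refine integral_congr_ae (.of_forall fun y => ?_)
  simp only [greenKernel, Complex.real_smul]
  push_cast
  ring

/-- The derivative of the potential as a Fourier transform. -/
theorem deriv_potential_eq_fourier (φ : 𝓓(segmentInterior, ℂ)) (x : ℝ) :
    deriv (potential φ) x = -(Complex.I / 2) *
      𝓕 (fun ξ => signSymbol ξ * 𝓕⁻ (φ : ℝ → ℂ) ξ) x := by
  rw [deriv_potential_eq_integral, Real.fourier_real_eq_integral_exp_smul, neg_mul, ← mul_neg,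
    ← integral_neg, ← integral_neg_eq_self]
  congr 1
  refine integral_congr_ae ?_
  -- `signSymbol` is odd only off the origin, where its value is `-1`.
  filter_upwards [Measure.ae_ne volume (0 : ℝ)] with ξ hξ
  have h1 : signSymbol (-ξ) = -signSymbol ξ := by
    unfold signSymbol
    rcases lt_or_gt_of_ne hξ with h | h
    · rw [if_pos (by linarith), if_neg (by linarith), neg_neg]
    · rw [if_neg (by linarith), if_pos h]
  rw [h1, Real.fourierInv_eq_fourier_neg, smul_eq_mul]
  rw [show ((2 * Real.pi * x * -ξ : ℝ) : ℂ) = ((-2 * Real.pi * ξ * x : ℝ) : ℂ) by push_cast; ring]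
  ring

end FlatScreen

/-! ### Products of `L²` functions and convolution of spectra -/

namespace FlatScreen

open FourierTransform Filter Topology

theorem ae_eq_zero_of_integral_schwartz_mul {f : ℝ → ℂ} (hf : LocallyIntegrable f)
    (h : ∀ ψ : 𝓢(ℝ, ℂ), ∫ x, ψ x * f x = 0) : ∀ᵐ x, f x = 0 := by
  refine ae_eq_zero_of_integral_contDiff_smul_eq_zero hf fun g hg hgc => ?_
  have hgc' : HasCompactSupport fun x => (g x : ℂ) := hgc.comp_left (g := ((↑) : ℝ → ℂ)) rfl
  simpa only [Complex.real_smul] using!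
    h (hgc'.toSchwartzMap (Complex.ofRealCLM.contDiff.comp hg))

theorem locallyIntegrable_Lp (f : Lp ℂ 2 (volume : Measure ℝ)) : LocallyIntegrable f :=
  (Lp.memLp f).locallyIntegrable (by norm_num)

theorem integral_mul_fourier_Lp (f : Lp ℂ 2 (volume : Measure ℝ)) (ψ : 𝓢(ℝ, ℂ)) :
    ∫ x, ψ x * (𝓕 f : Lp ℂ 2 (volume : Measure ℝ)) x = ∫ x, 𝓕 ψ x * f x := by
  have h := DFunLike.congr_fun (Lp.fourier_toTemperedDistribution_eq f) ψ
  rw [TemperedDistribution.fourier_apply, Lp.toTemperedDistribution_apply,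
    Lp.toTemperedDistribution_apply] at h
  exact h.symm

theorem integral_mul_fourierInv_Lp (f : Lp ℂ 2 (volume : Measure ℝ)) (ψ : 𝓢(ℝ, ℂ)) :
    ∫ x, ψ x * (𝓕⁻ f : Lp ℂ 2 (volume : Measure ℝ)) x = ∫ x, 𝓕⁻ ψ x * f x := by
  have h := DFunLike.congr_fun (Lp.fourierInv_toTemperedDistribution_eq f) ψ
  rw [TemperedDistribution.fourierInv_apply, Lp.toTemperedDistribution_apply,
    Lp.toTemperedDistribution_apply] at h
  exact h.symm

theorem integrable_bounded_mul {f g : ℝ → ℂ} {C : ℝ} (hf : AEStronglyMeasurable f)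
    (hC : ∀ x, ‖f x‖ ≤ C) (hg : Integrable g) : Integrable fun x => f x * g x :=
  hg.bdd_mul hf (.of_forall hC)

theorem integrable_schwartz_mul_of_integrable (ψ : 𝓢(ℝ, ℂ)) {g : ℝ → ℂ} (hg : Integrable g) :
    Integrable fun x => ψ x * g x :=
  integrable_bounded_mul ψ.continuous.aestronglyMeasurable (ψ.toBoundedContinuousFunction.norm_coe_le_norm) hg

/-- The `L²` Fourier transform of an integrable function is its classical Fourier transform. -/
theorem fourier_Lp_ae_eq (v : Lp ℂ 2 (volume : Measure ℝ)) (hv : Integrable v) :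
    (𝓕 v : Lp ℂ 2 (volume : Measure ℝ)) =ᵐ[volume] 𝓕 (v : ℝ → ℂ) := by
  have hc := continuous_fourier_of_integrable hv
  have h := ae_eq_zero_of_integral_schwartz_mul
    ((locallyIntegrable_Lp (𝓕 v)).sub hc.locallyIntegrable) fun ψ => by
      have i2 : Integrable fun x => ψ x * 𝓕 (v : ℝ → ℂ) x := by
        refine ψ.integrable.mul_bdd (c := ∫ x, ‖v x‖) hc.aestronglyMeasurable
          (.of_forall fun ξ => ?_)
        exact VectorFourier.norm_fourierIntegral_le_integral_norm _ _ _ _ _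
      simp only [Pi.sub_apply, mul_sub]
      rw [integral_sub (integrable_schwartz_mul ψ _) i2, integral_mul_fourier_Lp,
        ← integral_fourier_mul_eq ψ.integrable hv, SchwartzMap.fourier_coe, sub_self]
  filter_upwards [h] with x hx
  exact sub_eq_zero.1 hx

theorem fourier_fourierInv_mul_schwartz (a b : 𝓢(ℝ, ℂ)) (ξ : ℝ) :
    𝓕 (fun x => 𝓕⁻ a x * 𝓕⁻ b x) ξ = ∫ t, a t * b (ξ - t) := by
  have h := SchwartzMap.convolution_apply (ContinuousLinearMap.mul ℂ ℂ) a b ξ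
  rw [show ∫ t, a t * b (ξ - t) = (a ⋆[ContinuousLinearMap.mul ℂ ℂ] b) ξ from rfl, ← h]
  change _ = 𝓕⁻ (SchwartzMap.pairing (ContinuousLinearMap.mul ℂ ℂ) (𝓕 a) (𝓕 b)) ξ
  simp only [SchwartzMap.fourierInv_coe]
  rw [Real.fourierInv_eq', Real.fourier_eq', ← integral_neg_eq_self]
  refine integral_congr_ae (.of_forall fun x => ?_)
  simp only [SchwartzMap.fourier_coe,
    Real.fourierInv_eq_fourier_neg, neg_neg, SchwartzMap.pairing_apply_apply]
  congr 3
  simp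

theorem measurePreserving_const_sub (ξ : ℝ) :
    MeasurePreserving (fun t : ℝ => ξ - t) volume volume :=
  Measure.measurePreserving_sub_left volume ξ

/-- The Fourier transform of a product of inverse Fourier transforms of square integrable functions
is a convolution. -/
theorem fourier_fourierInv_mul (A B : Lp ℂ 2 (volume : Measure ℝ)) (ξ : ℝ) :
    𝓕 (fun x => (𝓕⁻ A : Lp ℂ 2 (volume : Measure ℝ)) x *
      (𝓕⁻ B : Lp ℂ 2 (volume : Measure ℝ)) x) ξ = ∫ t, A t * B (ξ - t) := by
  -- With the character regarded as an `L^∞` multiplier, both sides become continuous bilinear forms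
  -- on `L²`, so it suffices to compare them on the dense Schwartz space.
  have hEm : MemLp (fun x : ℝ => (Real.fourierChar (-(x * ξ)) : ℂ)) ⊤ volume := by
    refine memLp_top_of_bound (Continuous.aestronglyMeasurable (by fun_prop)) 1
      (.of_forall fun x => (Circle.norm_coe _).le)
  set E := hEm.toLp with hE
  set m := ContinuousLinearMap.mul ℂ ℂ with hm
  have hl (A B : Lp ℂ 2 (volume : Measure ℝ)) :
      𝓕 (fun x => (𝓕⁻ A : Lp ℂ 2 (volume : Measure ℝ)) x *
        (𝓕⁻ B : Lp ℂ 2 (volume : Measure ℝ)) x) ξ =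
      m.lpPairing volume 2 2 (𝓕⁻ A) (m.holderL volume ⊤ 2 2 E (𝓕⁻ B)) := by
    rw [ContinuousLinearMap.lpPairing_eq_integral, Real.fourier_real_eq]
    refine integral_congr_ae ?_
    filter_upwards [m.coeFn_holder (r := 2) E (𝓕⁻ B), hEm.coeFn_toLp] with x h1 h2
    rw [ContinuousLinearMap.holderL_apply_apply, h1, h2]
    simp only [hm, ContinuousLinearMap.mul_apply', Circle.smul_def, smul_eq_mul]
    ring
  have hr (A B : Lp ℂ 2 (volume : Measure ℝ)) : ∫ t, A t * B (ξ - t) =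
      m.lpPairing volume 2 2 A (Lp.compMeasurePreserving _ (measurePreserving_const_sub ξ) B) := by
    rw [ContinuousLinearMap.lpPairing_eq_integral]
    refine integral_congr_ae ?_
    filter_upwards [Lp.coeFn_compMeasurePreserving B (measurePreserving_const_sub ξ)] with x h1
    rw [h1]
    rfl
  rw [hl, hr]
  have hd : DenseRange fun ψ : 𝓢(ℝ, ℂ) => ψ.toLp 2 (volume : Measure ℝ) :=
    SchwartzMap.denseRange_toLpCLM ENNReal.ofNat_ne_top
  have hF : Continuous fun A : Lp ℂ 2 (volume : Measure ℝ) => 𝓕⁻ A :=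
    (Lp.fourierTransformₗᵢ ℝ ℂ).symm.continuous
  have hT : Continuous fun A : Lp ℂ 2 (volume : Measure ℝ) =>
      Lp.compMeasurePreserving _ (measurePreserving_const_sub ξ) A :=
    (Lp.isometry_compMeasurePreserving _).continuous
  refine hd.induction_on₂ (p := fun A B => m.lpPairing volume 2 2 (𝓕⁻ A)
    (m.holderL volume ⊤ 2 2 E (𝓕⁻ B)) = m.lpPairing volume 2 2 A
      (Lp.compMeasurePreserving _ (measurePreserving_const_sub ξ) B)) ?_ (fun a b => ?_) A B
  · refine isClosed_eq ?_ ?_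
    · exact ((m.lpPairing volume 2 2).continuous.comp (hF.comp continuous_fst)).clm_apply
        ((m.holderL volume ⊤ 2 2 E).continuous.comp (hF.comp continuous_snd))
    · exact ((m.lpPairing volume 2 2).continuous.comp continuous_fst).clm_apply
        (hT.comp continuous_snd)
  · rw [← hl, ← hr]
    have h1 : 𝓕 (fun x => (𝓕⁻ (a.toLp 2 (volume : Measure ℝ)) : Lp ℂ 2 (volume : Measure ℝ)) x *
        (𝓕⁻ (b.toLp 2 (volume : Measure ℝ)) : Lp ℂ 2 (volume : Measure ℝ)) x) ξ =
        𝓕 (fun x => 𝓕⁻ a x * 𝓕⁻ b x) ξ := by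
      rw [Real.fourier_eq, Real.fourier_eq]
      refine integral_congr_ae ?_
      rw [SchwartzMap.toLp_fourierInv_eq, SchwartzMap.toLp_fourierInv_eq]
      filter_upwards [(𝓕⁻ a).coeFn_toLp 2 volume, (𝓕⁻ b).coeFn_toLp 2 volume] with x h1 h2
      rw [h1, h2]
    rw [h1, fourier_fourierInv_mul_schwartz]
    refine integral_congr_ae ?_
    filter_upwards [a.coeFn_toLp 2 volume, (measurePreserving_const_sub ξ).quasiMeasurePreserving.ae
      (b.coeFn_toLp 2 volume)] with x h1 h2
    rw [h1, h2]

/-- The square of a function with one-sided spectrum has one-sided spectrum. -/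
theorem fourier_fourierInv_sq_eq_zero (G : Lp ℂ 2 (volume : Measure ℝ)) {s : Set ℝ} {ξ : ℝ}
    (hG : ∀ᵐ t, t ∉ s → G t = 0) (hs : ∀ t ∈ s, ξ - t ∉ s) :
    𝓕 (fun x => (𝓕⁻ G : Lp ℂ 2 (volume : Measure ℝ)) x *
      (𝓕⁻ G : Lp ℂ 2 (volume : Measure ℝ)) x) ξ = 0 := by
  rw [fourier_fourierInv_mul]
  refine integral_eq_zero_of_ae ?_
  filter_upwards [hG, (measurePreserving_const_sub ξ).quasiMeasurePreserving.ae hG] with t h1 h2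
  by_cases ht : t ∈ s
  · rw [h2 (hs t ht), mul_zero]
    rfl
  · rw [h1 ht, zero_mul]
    rfl

end FlatScreen

/-! ### Functions with one-sided spectrum and constant Hilbert transforms -/

namespace FlatScreen

open FourierTransform Filter Topology

/-- The restriction of a square integrable function to a set. -/
noncomputable def restrictLp (V : Lp ℂ 2 (volume : Measure ℝ)) {s : Set ℝ} (hs : MeasurableSet s) :
    Lp ℂ 2 (volume : Measure ℝ) :=
  ((Lp.memLp V).indicator hs).toLp

theorem coeFn_restrictLp (V : Lp ℂ 2 (volume : Measure ℝ)) {s : Set ℝ} (hs : MeasurableSet s) :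
    restrictLp V hs =ᵐ[volume] s.indicator V :=
  MemLp.coeFn_toLp _

theorem restrictLp_add_restrictLp (V : Lp ℂ 2 (volume : Measure ℝ)) :
    restrictLp V (measurableSet_Ioi (a := (0 : ℝ))) +
      restrictLp V (measurableSet_Iic (a := (0 : ℝ))) = V := by
  refine Lp.ext ?_
  filter_upwards [Lp.coeFn_add (restrictLp V (measurableSet_Ioi (a := (0 : ℝ))))
    (restrictLp V (measurableSet_Iic (a := (0 : ℝ)))),
    coeFn_restrictLp V (measurableSet_Ioi (a := (0 : ℝ))),
    coeFn_restrictLp V (measurableSet_Iic (a := (0 : ℝ)))] with x h h1 h2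
  rw [h, Pi.add_apply, h1, h2]
  rcases lt_or_ge 0 x with hx | hx
  · simp [hx, hx.not_ge]
  · simp [hx, hx.not_gt]

theorem coeFn_restrictLp_sub_restrictLp (V : Lp ℂ 2 (volume : Measure ℝ)) :
    ⇑(restrictLp V (measurableSet_Ioi (a := (0 : ℝ))) -
      restrictLp V (measurableSet_Iic (a := (0 : ℝ)))) =ᵐ[volume] fun ξ => signSymbol ξ * V ξ := by
  filter_upwards [Lp.coeFn_sub (restrictLp V (measurableSet_Ioi (a := (0 : ℝ))))
    (restrictLp V (measurableSet_Iic (a := (0 : ℝ)))),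
    coeFn_restrictLp V (measurableSet_Ioi (a := (0 : ℝ))),
    coeFn_restrictLp V (measurableSet_Iic (a := (0 : ℝ)))] with x h h1 h2
  rw [h, Pi.sub_apply, h1, h2, signSymbol]
  rcases lt_or_ge 0 x with hx | hx
  · simp [hx, hx.not_ge]
  · simp [hx, hx.not_gt]

theorem integrable_of_ae_eq_zero (v : Lp ℂ 2 (volume : Measure ℝ))
    (hv : ∀ᵐ x, x ∉ Set.Icc (-1 : ℝ) 1 → v x = 0) : Integrable v := by
  have h := IntegrableOn.integrable_indicator
    ((locallyIntegrable_Lp v).integrableOn_isCompact isCompact_Icc)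
    (measurableSet_Icc (a := (-1 : ℝ)) (b := 1))
  refine h.congr ?_
  filter_upwards [hv] with x hx
  by_cases hx1 : x ∈ Set.Icc (-1 : ℝ) 1
  · rw [Set.indicator_of_mem hx1]
  · rw [Set.indicator_of_notMem hx1, hx hx1]

/-- The derivative of the potential is dual to the Hilbert transform. -/
theorem integral_mul_deriv_potential (v : Lp ℂ 2 (volume : Measure ℝ)) (hv : Integrable v)
    (φ : 𝓓(segmentInterior, ℂ)) :
    ∫ x, v x * deriv (potential φ) x = -(Complex.I / 2) *
      ∫ x, φ x * (𝓕⁻ (restrictLp (𝓕 v) (measurableSet_Ioi (a := (0 : ℝ))) -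
        restrictLp (𝓕 v) (measurableSet_Iic (a := (0 : ℝ)))) : Lp ℂ 2 (volume : Measure ℝ)) x := by
  have hφ : Integrable (𝓕⁻ (φ : ℝ → ℂ)) := by
    have := (𝓕⁻ (testToSchwartz φ)).integrable (μ := volume)
    rwa [SchwartzMap.fourierInv_coe] at this
  have hg : Integrable fun ξ => signSymbol ξ * 𝓕⁻ (φ : ℝ → ℂ) ξ :=
    integrable_bounded_mul measurable_signSymbol.aestronglyMeasurable
      (fun ξ => (norm_signSymbol ξ).le) hφ
  have h1 := integral_mul_fourierInv_Lp (restrictLp (𝓕 v) (measurableSet_Ioi (a := (0 : ℝ))) -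
        restrictLp (𝓕 v) (measurableSet_Iic (a := (0 : ℝ)))) (testToSchwartz φ)
  simp only [testToSchwartz_apply] at h1
  rw [h1]
  simp only [deriv_potential_eq_fourier, mul_left_comm _ (-(Complex.I / 2))]
  rw [integral_const_mul, ← integral_fourier_mul_eq hv hg]
  congr 1
  refine integral_congr_ae ?_
  filter_upwards [coeFn_restrictLp_sub_restrictLp (𝓕 v), fourier_Lp_ae_eq v hv] with ξ h2 h3
  rw [h2, h3, SchwartzMap.fourierInv_coe]
  change _ = 𝓕⁻ (φ : ℝ → ℂ) ξ * _
  ring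

/-- A real smooth function compactly supported in `(-1, 1)`, as a test function. -/
noncomputable def testOfReal (g : ℝ → ℝ) (hg : ContDiff ℝ ∞ g) (hc : HasCompactSupport g)
    (hs : tsupport g ⊆ Set.Ioo (-1) 1) : 𝓓(segmentInterior, ℂ) where
  toFun x := (g x : ℂ)
  contDiff' := Complex.ofRealCLM.contDiff.comp hg
  hasCompactSupport' := hc.comp_left (g := ((↑) : ℝ → ℂ)) rfl
  tsupport_subset' := (closure_mono fun x (hx : (g x : ℂ) ≠ 0) (h : g x = 0) => hx (by
    rw [h, Complex.ofReal_zero])).trans hs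

theorem testOfReal_apply (g : ℝ → ℝ) (hg : ContDiff ℝ ∞ g) (hc : HasCompactSupport g)
    (hs : tsupport g ⊆ Set.Ioo (-1) 1) (x : ℝ) : testOfReal g hg hc hs x = (g x : ℂ) := rfl

theorem integrable_Lp_mul (f g : Lp ℂ 2 (volume : Measure ℝ)) : Integrable fun x => f x * g x :=
  (Lp.memLp f).integrable_mul (Lp.memLp g)

theorem integral_fourier_mul_quadratic (G : Lp ℂ 2 (volume : Measure ℝ)) (c : ℂ) (ψ : 𝓢(ℝ, ℂ)) :
    ∫ x, 𝓕 ψ x * ((𝓕⁻ G : Lp ℂ 2 (volume : Measure ℝ)) x *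
      (𝓕⁻ G : Lp ℂ 2 (volume : Measure ℝ)) x + c * (𝓕⁻ G : Lp ℂ 2 (volume : Measure ℝ)) x) =
    ∫ ξ, ψ ξ * (𝓕 (fun x => (𝓕⁻ G : Lp ℂ 2 (volume : Measure ℝ)) x *
      (𝓕⁻ G : Lp ℂ 2 (volume : Measure ℝ)) x) ξ + c * G ξ) := by
  set f : Lp ℂ 2 (volume : Measure ℝ) := 𝓕⁻ G with hf
  have hG : G = 𝓕 f := by rw [hf, FourierTransform.fourier_fourierInv_eq]
  have hff := integrable_Lp_mul f f
  simp only [mul_add, mul_left_comm _ c]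
  rw [integral_add, integral_add, integral_const_mul, integral_const_mul]
  · congr 1
    · rw [SchwartzMap.fourier_coe]
      exact integral_fourier_mul_eq ψ.integrable hff
    · rw [hG, integral_mul_fourier_Lp]
  · refine ψ.integrable.mul_bdd (c := ∫ x, ‖f x * f x‖)
      (continuous_fourier_of_integrable hff).aestronglyMeasurable (.of_forall fun ξ => ?_)
    exact VectorFourier.norm_fourierIntegral_le_integral_norm _ _ _ _ _
  · exact (integrable_schwartz_mul ψ G).const_mul c
  · exact integrable_schwartz_mul_of_integrable _ hff
  · exact (integrable_schwartz_mul _ f).const_mul c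

theorem locallyIntegrable_fourier_add (G : Lp ℂ 2 (volume : Measure ℝ)) (c : ℂ) :
    LocallyIntegrable fun ξ => 𝓕 (fun x => (𝓕⁻ G : Lp ℂ 2 (volume : Measure ℝ)) x *
      (𝓕⁻ G : Lp ℂ 2 (volume : Measure ℝ)) x) ξ + c * G ξ :=
  (continuous_fourier_of_integrable (integrable_Lp_mul _ _)).locallyIntegrable.add
    ((locallyIntegrable_Lp G).smul c)

/-- Functions with spectra on opposite half-lines that satisfy a quadratic relation. -/
theorem quadratic_eq_zero {G H : Lp ℂ 2 (volume : Measure ℝ)} {c : ℂ}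
    (hG : ∀ᵐ t, t ∉ Set.Ioi (0 : ℝ) → G t = 0) (hH : ∀ᵐ t, t ∉ Set.Iic (0 : ℝ) → H t = 0)
    (h : ∀ᵐ x, (𝓕⁻ G : Lp ℂ 2 (volume : Measure ℝ)) x * (𝓕⁻ G : Lp ℂ 2 (volume : Measure ℝ)) x +
        -c * (𝓕⁻ G : Lp ℂ 2 (volume : Measure ℝ)) x =
      (𝓕⁻ H : Lp ℂ 2 (volume : Measure ℝ)) x * (𝓕⁻ H : Lp ℂ 2 (volume : Measure ℝ)) x +
        c * (𝓕⁻ H : Lp ℂ 2 (volume : Measure ℝ)) x) :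
    ∀ᵐ x, (𝓕⁻ G : Lp ℂ 2 (volume : Measure ℝ)) x * (𝓕⁻ G : Lp ℂ 2 (volume : Measure ℝ)) x +
        -c * (𝓕⁻ G : Lp ℂ 2 (volume : Measure ℝ)) x = 0 := by
  have hGi := locallyIntegrable_fourier_add G (-c)
  have hHi := locallyIntegrable_fourier_add H c
  have hint {F : ℝ → ℂ} {f : Lp ℂ 2 (volume : Measure ℝ)} {a : ℂ} (ψ : 𝓢(ℝ, ℂ))
      (hF : F = fun ξ => 𝓕 (fun x => (𝓕⁻ f : Lp ℂ 2 (volume : Measure ℝ)) x *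
        (𝓕⁻ f : Lp ℂ 2 (volume : Measure ℝ)) x) ξ + a * f ξ) :
      Integrable fun ξ => ψ ξ * F ξ := by
    have hff := integrable_Lp_mul (𝓕⁻ f) (𝓕⁻ f)
    simp only [hF, mul_add, mul_left_comm _ a]
    refine Integrable.add ?_ ((integrable_schwartz_mul ψ f).const_mul a)
    refine ψ.integrable.mul_bdd (c := ∫ x, ‖(𝓕⁻ f : Lp ℂ 2 (volume : Measure ℝ)) x *
        (𝓕⁻ f : Lp ℂ 2 (volume : Measure ℝ)) x‖)
      (continuous_fourier_of_integrable hff).aestronglyMeasurable (.of_forall fun ξ => ?_)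
    exact VectorFourier.norm_fourierIntegral_le_integral_norm _ _ _ _ _
  have heq := ae_eq_zero_of_integral_schwartz_mul (hGi.sub hHi) fun ψ => by
    simp only [Pi.sub_apply, mul_sub]
    rw [integral_sub (hint ψ rfl) (hint ψ rfl), ← integral_fourier_mul_quadratic,
      ← integral_fourier_mul_quadratic, sub_eq_zero]
    refine integral_congr_ae ?_
    filter_upwards [h] with x hx
    rw [hx]
  have hzero : ∀ᵐ ξ, 𝓕 (fun x => (𝓕⁻ G : Lp ℂ 2 (volume : Measure ℝ)) x *
      (𝓕⁻ G : Lp ℂ 2 (volume : Measure ℝ)) x) ξ + -c * G ξ = 0 := by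
    filter_upwards [heq, hG, hH] with ξ h0 h1 h2
    -- For `ξ ≤ 0` both terms built from `G` vanish outright; for `ξ > 0` those built from `H` do,
    -- and the equality of transforms carries this over to `G`.
    rcases le_or_gt ξ 0 with hξ | hξ
    · rw [h1 (not_lt.2 hξ), fourier_fourierInv_sq_eq_zero G hG fun t ht h => ?_, mul_zero,
        add_zero]
      rw [Set.mem_Ioi] at ht h
      linarith
    · rw [Pi.sub_apply, h2 (not_le.2 hξ), fourier_fourierInv_sq_eq_zero H hH fun t ht h => ?_,
        mul_zero, add_zero, sub_zero] at h0
      · exact h0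
      · rw [Set.mem_Iic] at ht h
        linarith
  refine ae_eq_zero_of_integral_schwartz_mul
    ((integrable_Lp_mul _ _).locallyIntegrable.add ((locallyIntegrable_Lp _).smul (-c)))
    fun ψ => ?_
  have h1 := integral_fourier_mul_quadratic G (-c) (𝓕⁻ ψ)
  rw [FourierTransform.fourier_fourierInv_eq] at h1
  refine h1.trans (integral_eq_zero_of_ae ?_)
  filter_upwards [hzero] with ξ hξ
  rw [hξ, mul_zero]
  rfl

/-- A real square integrable function supported in `[-1, 1]` whose Hilbert transform is constant on
`(-1, 1)` vanishes. -/
theorem eq_zero_of_integral_mul_deriv_potential (v : Lp ℂ 2 (volume : Measure ℝ))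
    (hv : ∀ᵐ x, x ∉ Set.Icc (-1 : ℝ) 1 → v x = 0) (hre : ∀ᵐ x, (v x).im = 0) (k : ℝ)
    (h : ∀ (g : ℝ → ℝ) (hg : ContDiff ℝ ∞ g) (hc : HasCompactSupport g)
      (hs : tsupport g ⊆ Set.Ioo (-1) 1),
      ∫ x, v x * deriv (potential (testOfReal g hg hc hs)) x = k * ∫ x, (g x : ℂ)) :
    ∀ᵐ x, v x = 0 := by
  have hvi := integrable_of_ae_eq_zero v hv
  set G := restrictLp (𝓕 v) (measurableSet_Ioi (a := (0 : ℝ))) with hG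
  set H := restrictLp (𝓕 v) (measurableSet_Iic (a := (0 : ℝ))) with hH
  have hG0 : ∀ᵐ t, t ∉ Set.Ioi (0 : ℝ) → G t = 0 := by
    filter_upwards [coeFn_restrictLp (𝓕 v) (measurableSet_Ioi (a := (0 : ℝ)))] with t h1 h2
    rw [hG, h1, Set.indicator_of_notMem h2]
  have hH0 : ∀ᵐ t, t ∉ Set.Iic (0 : ℝ) → H t = 0 := by
    filter_upwards [coeFn_restrictLp (𝓕 v) (measurableSet_Iic (a := (0 : ℝ)))] with t h1 h2
    rw [hH, h1, Set.indicator_of_notMem h2]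
  have hadd : ∀ᵐ x, v x = (𝓕⁻ G : Lp ℂ 2 (volume : Measure ℝ)) x +
      (𝓕⁻ H : Lp ℂ 2 (volume : Measure ℝ)) x := by
    have h1 : v = 𝓕⁻ G + 𝓕⁻ H := by
      rw [← FourierTransform.fourierInv_add, hG, hH, restrictLp_add_restrictLp,
        FourierTransform.fourierInv_fourier_eq]
    filter_upwards [Lp.coeFn_add (𝓕⁻ G) (𝓕⁻ H)] with x hx
    conv_lhs => rw [h1]
    rw [hx, Pi.add_apply]
  have hsub : (𝓕⁻ (G - H) : Lp ℂ 2 (volume : Measure ℝ)) =ᵐ[volume]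
      fun x => (𝓕⁻ G : Lp ℂ 2 (volume : Measure ℝ)) x -
        (𝓕⁻ H : Lp ℂ 2 (volume : Measure ℝ)) x := by
    have h1 : (𝓕⁻ (G - H) : Lp ℂ 2 (volume : Measure ℝ)) = 𝓕⁻ G - 𝓕⁻ H :=
      (Lp.fourierTransformₗᵢ ℝ ℂ).symm.map_sub G H
    rw [h1]
    exact Lp.coeFn_sub _ _
  -- The constant solves `-(i/2) κ = k`.
  set κ : ℂ := 2 * Complex.I * k with hκ
  have hs : ∀ᵐ x, x ∈ Set.Ioo (-1 : ℝ) 1 → (𝓕⁻ (G - H) : Lp ℂ 2 (volume : Measure ℝ)) x - κ = 0 := by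
    refine isOpen_Ioo.ae_eq_zero_of_integral_contDiff_smul_eq_zero
      (((locallyIntegrable_Lp _).sub (continuous_const.locallyIntegrable)).locallyIntegrableOn _)
      fun g hg hc hs => ?_
    have h1 := h g hg hc hs
    rw [integral_mul_deriv_potential v hvi] at h1
    simp only [testOfReal_apply] at h1
    have i1 := integrable_schwartz_mul (testToSchwartz (testOfReal g hg hc hs)) (𝓕⁻ (G - H))
    have i2 : Integrable fun x => (g x : ℂ) :=
      (testToSchwartz (testOfReal g hg hc hs)).integrable
    simp only [testToSchwartz_apply, testOfReal_apply] at i1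
    simp only [Complex.real_smul, mul_sub]
    rw [integral_sub i1 (i2.mul_const κ), integral_mul_const, hκ]
    linear_combination (2 * Complex.I) * h1 + (∫ x, (g x : ℂ) *
      (𝓕⁻ (G - H) : Lp ℂ 2 (volume : Measure ℝ)) x) * Complex.I_sq
  have hend : ∀ᵐ x : ℝ, x ≠ -1 ∧ x ≠ 1 :=
    (Measure.ae_ne volume (-1 : ℝ)).and (Measure.ae_ne volume (1 : ℝ))
  have hcases : ∀ᵐ x, (x ∈ Set.Ioo (-1 : ℝ) 1 ∧ (𝓕⁻ G : Lp ℂ 2 (volume : Measure ℝ)) x -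
      (𝓕⁻ H : Lp ℂ 2 (volume : Measure ℝ)) x = κ) ∨ v x = 0 := by
    filter_upwards [hs, hv, hend, hsub] with x h1 h2 h3 h4
    by_cases hx : x ∈ Set.Ioo (-1 : ℝ) 1
    · left
      rw [h4] at h1
      exact ⟨hx, sub_eq_zero.1 (h1 hx)⟩
    · right
      refine h2 fun h5 => hx ⟨lt_of_le_of_ne h5.1 h3.1.symm, lt_of_le_of_ne h5.2 h3.2⟩
  -- The relation is `(f₊ + f₋)(f₊ - f₋ - κ) = 0`: the second factor vanishes on `(-1, 1)` and the
  -- first, equal to `v`, elsewhere.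
  have hq := quadratic_eq_zero (c := κ) hG0 hH0 (by
    filter_upwards [hcases, hadd] with x h1 h2
    rcases h1 with ⟨-, h1⟩ | h1
    · rw [← h1]
      ring
    · rw [h1] at h2
      rw [eq_neg_of_add_eq_zero_left h2.symm]
      ring)
  filter_upwards [hcases, hadd, hq, hre] with x h1 h2 h3 h4
  rcases h1 with ⟨-, h1⟩ | h1
  · have h5 : v x * v x = κ * κ := by
      rw [h2, ← h1]
      rw [← h1] at h3
      linear_combination 4 * h3
    have h6 : v x = ((v x).re : ℂ) := by
      apply Complex.ext <;> simp [h4]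
    rw [h6, hκ] at h5
    have h7 : (((v x).re * (v x).re : ℝ) : ℂ) = ((-(4 * (k * k)) : ℝ) : ℂ) := by
      push_cast
      linear_combination h5 + 4 * (k : ℂ) ^ 2 * Complex.I_sq
    have h8 : (v x).re * (v x).re = -(4 * (k * k)) := by exact_mod_cast h7
    have h9 : (v x).re = 0 := by nlinarith [mul_self_nonneg k, mul_self_nonneg (v x).re]
    rw [h6, h9, Complex.ofReal_zero]
  · exact h1

end FlatScreen

/-! ### Injectivity of the single-layer operator and conclusion -/

namespace FlatScreen

open FourierTransform Filter Topology

theorem deriv_potential_testOfReal (g : ℝ → ℝ) (hg : ContDiff ℝ ∞ g) (hc : HasCompactSupport g)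
    (hs : tsupport g ⊆ Set.Ioo (-1) 1) (x : ℝ) :
    deriv (potential (testOfReal g hg hc hs)) x =
      ((∫ y, greenKernel (x - y) * deriv g y : ℝ) : ℂ) := by
  rw [deriv_potential, ← integral_complex_ofReal]
  refine integral_congr_ae (.of_forall fun y => ?_)
  have h : deriv (testOfReal g hg hc hs) y = ((deriv g y : ℝ) : ℂ) :=
    (((contDiff_infty_iff_deriv.1 hg).1 y).hasDerivAt.ofReal_comp).deriv
  simp only [h, Complex.real_smul, Complex.ofReal_mul]

/-- The derivative of the potential is bounded, being the Fourier transform of an integrable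
function. -/
theorem integrable_mul_deriv_potential {v : ℝ → ℂ} (hv : Integrable v)
    (φ : 𝓓(segmentInterior, ℂ)) : Integrable fun x => v x * deriv (potential φ) x := by
  refine hv.mul_bdd (c := ∫ ξ, ‖-(Complex.I / 2)‖ * ‖signSymbol ξ * 𝓕⁻ (φ : ℝ → ℂ) ξ‖)
    (contDiff_infty_iff_deriv.1 (contDiff_potential φ)).2.continuous.aestronglyMeasurable
    (.of_forall fun x => ?_)
  rw [deriv_potential_eq_fourier, norm_mul, integral_const_mul]
  exact mul_le_mul_of_nonneg_left
    (VectorFourier.norm_fourierIntegral_le_integral_norm _ _ _ _ _) (norm_nonneg _)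

/-- A square integrable function supported in `[-1, 1]` whose Hilbert transform is constant on
`(-1, 1)` vanishes. -/
theorem ae_eq_zero_of_integral_mul_deriv_potential (v : Lp ℂ 2 (volume : Measure ℝ))
    (hv : ∀ᵐ x, x ∉ Set.Icc (-1 : ℝ) 1 → v x = 0) (k : ℂ)
    (h : ∀ φ : 𝓓(segmentInterior, ℂ), ∫ x, v x * deriv (potential φ) x = k * ∫ x, φ x) :
    ∀ᵐ x, v x = 0 := by
  have hvi := integrable_of_ae_eq_zero v hv
  -- For real test functions the derivative of the potential is real, so the hypothesis passes to
  -- the real and imaginary parts of `v`, with `k` replaced by `L k`.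
  have key (L : ℂ →L[ℝ] ℝ) : ∀ᵐ x, L (v x) = 0 := by
    have hm : MemLp (fun x => ((L (v x) : ℝ) : ℂ)) 2 :=
      (Complex.ofRealCLM.comp L).comp_memLp' (Lp.memLp v)
    have hw := hm.coeFn_toLp
    have h0 := eq_zero_of_integral_mul_deriv_potential hm.toLp
      (by
        filter_upwards [hw, hv] with x h1 h2 h3
        rw [h1, h2 h3, map_zero, Complex.ofReal_zero])
      (by
        filter_upwards [hw] with x h1
        rw [h1, Complex.ofReal_im]) (L k) fun g hg hc hs => ?_
    · filter_upwards [h0, hw] with x h1 h2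
      rw [h2] at h1
      exact_mod_cast h1
    · have h1 := congrArg L (h (testOfReal g hg hc hs))
      rw [← L.integral_comp_comm (integrable_mul_deriv_potential hvi _)] at h1
      have h2 (a : ℂ) (r : ℝ) : L (a * r) = L a * r := by
        rw [mul_comm, ← Complex.real_smul, map_smul, smul_eq_mul, mul_comm]
      simp only [testOfReal_apply, deriv_potential_testOfReal, h2] at h1 ⊢
      rw [integral_complex_ofReal, h2] at h1
      rw [integral_complex_ofReal, ← Complex.ofReal_mul, ← h1, ← integral_complex_ofReal]
      refine integral_congr_ae ?_
      filter_upwards [hw] with x hx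
      rw [hx, Complex.ofReal_mul]
  filter_upwards [key Complex.reCLM, key Complex.imCLM] with x h1 h2
  exact Complex.ext h1 h2

theorem HTilde.sub_smul {u w : 𝓢'(ℝ, ℂ)} (hu : u ∈ HTilde (-1 / 2)) (hw : w ∈ HTilde (-1 / 2))
    (c : ℂ) : u - c • w ∈ HTilde (-1 / 2) := by
  refine ⟨hu.1.sub (hw.1.smul c), Set.sInter_subset_of_mem ⟨fun φ hφ => ?_, isClosed_Icc⟩⟩
  rw [_root_.sub_apply, _root_.smul_apply,
    apply_eq_zero_of_tsupport_subset (HTilde.memSobolev hu) hu.2 hφ,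
    apply_eq_zero_of_tsupport_subset (HTilde.memSobolev hw) hw.2 hφ, smul_zero, sub_zero]

/-- The density `1 / √(1 - x²)`, as a distribution. -/
noncomputable def equilibrium : 𝓢'(ℝ, ℂ) :=
  weightedDistribution (α := fun _ => 1) continuousOn_const

theorem equilibrium_mem : equilibrium ∈ HTilde (-1 / 2) :=
  weightedDistribution_mem contDiffOn_const

theorem equilibrium_cutoff : equilibrium (cutoffMul (fun _ => 1) contDiff_const) = Real.pi := by
  rw [equilibrium, weightedDistribution, ofIntegrable_apply, integral_mul_weighted]
  simp [cutoffMul_apply, cutoff_eq_one (Real.cos_mem_Icc _)]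

theorem singleLayer_equilibrium (φ : 𝓓(segmentInterior, ℂ)) :
    singleLayer equilibrium φ = (Real.log 2 / 2 : ℝ) * ∫ x, φ x := by
  have h1 : ∫ x in Set.Ioo (-1 : ℝ) 1, φ x = ∫ x, φ x :=
    setIntegral_eq_integral_of_forall_compl_eq_zero fun x hx => testFunction_eq_zero φ hx
  rw [equilibrium, singleLayer_weightedDistribution, ← h1, ← integral_const_mul]
  refine setIntegral_congr_fun measurableSet_Ioo fun y hy => ?_
  simp only [one_mul]
  rw [intervalIntegral.integral_ofReal]
  have h := integral_cos_mul_greenKernel 0 (Set.Ioo_subset_Icc_self hy)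
  simp only [Int.cast_zero, zero_mul, Real.cos_zero, one_mul, layerEigenvalue, if_pos,
    Polynomial.Chebyshev.T_zero, Polynomial.eval_one, mul_one] at h
  rw [h]

theorem singleLayer_sub_smul (u w : 𝓢'(ℝ, ℂ)) (c : ℂ) (φ : 𝓓(segmentInterior, ℂ)) :
    singleLayer (u - c • w) φ = singleLayer u φ - c * singleLayer w φ := rfl

theorem deriv_cutoffPotential (φ : 𝓓(segmentInterior, ℂ)) {x : ℝ} (hx : x ∈ Set.Icc (-1 : ℝ) 1) :
    deriv (cutoffPotential φ) x = deriv (potential φ) x := by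
  refine EventuallyEq.deriv_eq ?_
  filter_upwards [isOpen_Ioo.mem_nhds (show x ∈ Set.Ioo (-2 : ℝ) 2 from
    ⟨by linarith [hx.1], by linarith [hx.2]⟩)] with y hy
  change cutoff y • potential φ y = _
  rw [cutoff_eq_one_of_mem_Ioo hy, one_smul]

/-- If `S₀ u` is constant and `u` has mean zero, then `u = 0`. -/
theorem eq_zero_of_singleLayer_eq_const {u : 𝓢'(ℝ, ℂ)} (hu : u ∈ HTilde (-1 / 2))
    (h0 : u (cutoffMul (fun _ => 1) contDiff_const) = 0) (k : ℂ)
    (h : ∀ φ : 𝓓(segmentInterior, ℂ), singleLayer u φ = k * ∫ x, φ x) : u = 0 := by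
  obtain ⟨v, hv, huv⟩ := exists_L2_primitive hu
  have hv0 := ae_eq_zero_of_integral_mul_deriv_potential v hv k fun φ => by
    rw [← h, singleLayer, huv, h0, mul_zero, zero_add]
    refine integral_congr_ae ?_
    filter_upwards [hv] with x hx
    by_cases hx1 : x ∈ Set.Icc (-1 : ℝ) 1
    · rw [deriv_cutoffPotential φ hx1, mul_comm]
    · rw [hx hx1, zero_mul, mul_zero]
  ext ψ
  rw [huv, h0, mul_zero, zero_add]
  refine integral_eq_zero_of_ae ?_
  filter_upwards [hv0] with x hx
  rw [hx, mul_zero]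
  rfl

theorem exists_integral_testFunction_ne_zero :
    ∃ φ : 𝓓(segmentInterior, ℂ), ∫ x, φ x ≠ 0 := by
  let b : ContDiffBump (0 : ℝ) := ⟨1 / 4, 1 / 2, by norm_num, by norm_num⟩
  refine ⟨testOfReal b b.contDiff b.hasCompactSupport ?_, ?_⟩
  · rw [b.tsupport_eq, Real.closedBall_eq_Icc]
    exact Set.Icc_subset_Ioo (by norm_num [b]) (by norm_num [b])
  · simp only [testOfReal_apply]
    rw [integral_complex_ofReal]
    exact_mod_cast b.integral_pos.ne'

/-- The single-layer operator is injective on `H̃^{-1/2}(-1, 1)`. -/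
theorem eq_zero_of_singleLayer_eq_zero {u : 𝓢'(ℝ, ℂ)} (hu : u ∈ HTilde (-1 / 2))
    (h : ∀ φ : 𝓓(segmentInterior, ℂ), singleLayer u φ = 0) : u = 0 := by
  -- The equilibrium density has total mass `π`, so `u - c • equilibrium` has mean zero.
  set c : ℂ := u (cutoffMul (fun _ => 1) contDiff_const) / Real.pi with hc
  have hpi : (Real.pi : ℂ) ≠ 0 := by exact_mod_cast Real.pi_ne_zero
  have h1 : u - c • equilibrium = 0 := by
    refine eq_zero_of_singleLayer_eq_const (HTilde.sub_smul hu equilibrium_mem c) ?_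
      (-(c * (Real.log 2 / 2 : ℝ))) fun φ => ?_
    · rw [_root_.sub_apply, _root_.smul_apply, equilibrium_cutoff, smul_eq_mul, hc,
        div_mul_cancel₀ _ hpi, sub_self]
    · rw [singleLayer_sub_smul, h, singleLayer_equilibrium]
      ring
  obtain ⟨φ, hφ⟩ := exists_integral_testFunction_ne_zero
  have h2 := singleLayer_sub_smul u equilibrium c φ
  rw [h1, h, singleLayer_equilibrium] at h2
  -- The decisive nonvanishing: the segment has logarithmic capacity `1/2`, and only for capacity
  -- `1` would the equilibrium potential be zero.
  have hlog : ((Real.log 2 / 2 : ℝ) : ℂ) ≠ 0 := by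
    exact_mod_cast (div_pos (Real.log_pos one_lt_two) two_pos).ne'
  have h3 : c * (((Real.log 2 / 2 : ℝ) : ℂ) * ∫ x, φ x) = 0 := by
    have h4 : singleLayer 0 φ = 0 := rfl
    rw [h4, zero_sub, eq_comm, neg_eq_zero] at h2
    exact h2
  rw [mul_eq_zero, or_iff_left (mul_ne_zero hlog hφ)] at h3
  ext ψ
  rw [sub_eq_zero.1 h1, h3, _root_.smul_apply]
  exact zero_mul _

theorem IsSolution.unique {u w : 𝓢'(ℝ, ℂ)} {g : ℝ → ℂ} (hu : IsSolution u g)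
    (hw : IsSolution w g) : u = w := by
  have h := eq_zero_of_singleLayer_eq_zero (HTilde.sub_smul hu.1 hw.1 1) fun φ => by
    rw [singleLayer_sub_smul, hu.2, hw.2, one_mul, sub_self]
  rwa [one_smul, sub_eq_zero] at h

end FlatScreen

theorem mainTheorem4 (g : ℝ → ℂ) (hg : ContDiffOn ℝ ∞ g (Set.Icc (-1) 1)) :
    (∃! u : 𝓢'(ℝ, ℂ), FlatScreen.IsSolution u g) ∧
      ∀ u : 𝓢'(ℝ, ℂ), FlatScreen.IsSolution u g →
        ∃ α : ℝ → ℂ, ContDiffOn ℝ ∞ α (Set.Icc (-1) 1) ∧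
          FlatScreen.IsRepresentedBy u (fun x => α x / (Real.sqrt (1 - x ^ 2) : ℂ)) := by
  obtain ⟨α, hα, hsol⟩ := FlatScreen.exists_weighted_solution hg
  refine ⟨⟨_, hsol, fun u hu => hu.unique hsol⟩, fun u hu => ⟨α, hα, ?_⟩⟩
  rw [hu.unique hsol]
  exact FlatScreen.isRepresentedBy_weightedDistribution hα.continuousOn
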